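/- **Proposition (convergence of moments and of finite-dimensional distributions).** For each $n\ge 1$ let $M(t)=M^{(n)}(t)$, $t\ge 0$, be the stationary $(n+1)\times(n+1)$ GOE Ornstein--Uhlenbeck process, all defined on one probability space: the continuous, centered, real-symmetric-matrix valued Gaussian process with $$\mathbb E[M(s)_{i,j}M(t)_{i',j'}]=\delta_{\{i,j\},\{i',j'\}}(1+\delta_{i,j})\,e^{-|t-s|}.$$ Let $\widetilde M(t)$ be $M(t)$ with its first row and first column replaced by zero, let $\theta(t)=n^{-1/2}\,(M(t)e_1-M(t)_{1,1}e_1)$, and let $P_m(x)=U_m(x/2)$, where $U_m$ is the Chebyshev polynomial of the second kind. Define $$\tilde a_1(t)=M(t)_{1,1},\qquad \tilde a_{k+1}(t)=\sqrt n\,\theta(t)^TP_{2k-1}\big(\widetilde M(t)/\sqrt n\big)\theta(t)\quad(k\ge1),$$ $$\tilde b_1(t)^2=n\|\theta(t)\|^2,\qquad \tilde b_{k+1}(t)^2=n+n\,\theta(t)^TP_{2k}\big(\widetilde M(t)/\sqrt n\big)\theta(t)\quad(k\ge1).$$ ($\tilde b_k(t)^2$ is only a name for the right-hand side, which may be negative.)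 Let $A_k$, $B_k$ ($k\ge1$) be jointly independent, continuous, centered Gaussian processes on $[0,\infty)$ with $\mathbb E[A_k(t)A_k(s)]=2e^{-(2k-1)|t-s|}$ and $\mathbb E[B_k(t)B_k(s)]=2e^{-2k|t-s|}$ (that is, $A_k=\sqrt2\,\mathrm{OU}(2k-1)$ and $B_k=\sqrt2\,\mathrm{OU}(2k)$). Write $\mathcal P_2(j)$ for the set of partitions of $\{1,\dots,j\}$ into blocks of size two (empty for odd $j$; for $j=0$ it contains only the empty partition). (i) For all $j_1,j_2\ge0$ and all $k_1,\dots,k_{j_1},k_1',\dots,k_{j_2}'\ge1$ there is a constant $C$ such that for all $n\ge1$ and all times $t_1,\dots,t_{j_1},t_1',\dots,t_{j_2}'\ge0$ the moment on the left below exists and $$\bigg|\,\mathbb E\Big[\prod_{i=1}^{j_1}\tilde a_{k_i}(t_i)\prod_{i=1}^{j_2}\frac{\tilde b_{k_i'}(t_i')^2-n}{\sqrt n}\Big]-\mathbb E\Big[\prod_{i=1}^{j_1}A_{k_i}(t_i)\prod_{i=1}^{j_2}B_{k_i'}(t_i')\Big]\bigg|\le \frac{C}{\sqrt n},$$ where $$\mathbb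 E\Big[\prod_{i=1}^{j_1}A_{k_i}(t_i)\prod_{i=1}^{j_2}B_{k_i'}(t_i')\Big]=\bigg(2^{j_1/2}\sum_{\pi\in\mathcal P_2(j_1)}\prod_{\{i_1,i_2\}\in\pi}\delta_{k_{i_1},k_{i_2}}e^{-(2k_{i_1}-1)|t_{i_1}-t_{i_2}|}\bigg)\bigg(2^{j_2/2}\sum_{\pi\in\mathcal P_2(j_2)}\prod_{\{i_1,i_2\}\in\pi}\delta_{k'_{i_1},k'_{i_2}}e^{-2k'_{i_1}|t'_{i_1}-t'_{i_2}|}\bigg).$$ (ii) For every $K$, put $\widetilde E_n(t)=\big(\tilde a_1(t),\dots,\tilde a_K(t),\tfrac{\tilde b_1(t)^2-n}{\sqrt n},\dots,\tfrac{\tilde b_K(t)^2-n}{\sqrt n}\big)$ and $E(t)=(A_1(t),\dots,A_K(t),B_1(t),\dots,B_K(t))$. Then for every $j$ and all $t_1,\dots,t_j\ge0$, as $n\to\infty$, $$(\widetilde E_n(t_1),\dots,\widetilde E_n(t_j))\to(E(t_1),\dots,E(t_j))\quad\text{in distribution.}$$ -/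

import Mathlib

open MeasureTheory ProbabilityTheory Filter
open scoped NNReal Matrix

noncomputable section

namespace TridiagGOE

/-- The stationary GOE Ornstein--Uhlenbeck process of size `d` (the stationary solution of
`dM = -M dt + √2 dB_GOE`), given by its law: a symmetric-matrix valued centered Gaussian process
with continuous paths and
`𝔼[M(s)_{ij} M(t)_{i'j'}] = δ_{{i,j},{i',j'}} (1 + δ_{ij}) exp(-|t - s|)`. -/
structure IsGOEProcess {Ω : Type*} [MeasurableSpace Ω] {d : ℕ}
    (M : ℝ≥0 → Ω → Matrix (Fin d) (Fin d) ℝ) (P : Measure Ω) : Prop where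
  isSymm : ∀ t ω, (M t ω).IsSymm
  gaussian : IsGaussianProcess
    (fun (p : ℝ≥0 × Fin d × Fin d) (ω : Ω) => M p.1 ω p.2.1 p.2.2) P
  centered : ∀ t i j, ∫ ω, M t ω i j ∂P = 0
  covariance : ∀ (s t : ℝ≥0) (i j i' j' : Fin d),
    ∫ ω, M s ω i j * M t ω i' j' ∂P =
      if s(i, j) = s(i', j') then
        (1 + if i = j then (1 : ℝ) else 0) * Real.exp (-|(t : ℝ) - (s : ℝ)|)
      else 0
  continuous_paths : ∀ᵐ ω ∂P, Continuous fun t => M t ω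

/-- The normalized stationary scalar Ornstein--Uhlenbeck process `OU(c)` (the stationary solution
of `dx = -c x dt + √(2c) dW`, `x(0) ∼ N(0,1)`): a centered Gaussian process with continuous paths
and `𝔼[x(s) x(t)] = exp(-c |t - s|)`. -/
structure IsOU {Ω : Type*} [MeasurableSpace Ω] (c : ℝ) (X : ℝ≥0 → Ω → ℝ) (P : Measure Ω) :
    Prop where
  gaussian : IsGaussianProcess X P
  centered : ∀ t, ∫ ω, X t ω ∂P = 0
  covariance : ∀ s t : ℝ≥0, ∫ ω, X s ω * X t ω ∂P = Real.exp (-(c * |(t : ℝ) - (s : ℝ)|))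
  continuous_paths : ∀ᵐ ω ∂P, Continuous fun t => X t ω

/-- The vector valued Ornstein--Uhlenbeck process with independent `OU(c i)` entries; the entries
are independent as processes. -/
structure IsVectorOU {Ω : Type*} [MeasurableSpace Ω] {ι : Type*} (c : ι → ℝ)
    (X : ι → ℝ≥0 → Ω → ℝ) (P : Measure Ω) : Prop where
  isOU : ∀ i, IsOU (c i) (X i) P
  indep : iIndepFun (fun (i : ι) (ω : Ω) (t : ℝ≥0) => X i t ω) P

/-- `M̃`: the first row and the first column of the matrix are replaced by zero. -/
def minor {n : ℕ} (A : Matrix (Fin (n + 1)) (Fin (n + 1)) ℝ) :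
    Matrix (Fin (n + 1)) (Fin (n + 1)) ℝ :=
  Matrix.of fun i j => if i = 0 ∨ j = 0 then 0 else A i j

/-- `θ = (M e₁ - M₁₁ e₁) / √n`: the first column without its diagonal entry, divided by `√n`,
where the matrix has size `n + 1`. -/
def theta {n : ℕ} (A : Matrix (Fin (n + 1)) (Fin (n + 1)) ℝ) : Fin (n + 1) → ℝ :=
  fun i => if i = 0 then 0 else A i 0 / √(n : ℝ)

/-- `θᵀ P_m(M̃ / √n) θ`, where `P_m(x) = U_m(x / 2)` is the monic rescaled Chebyshev polynomial of
the second kind, which is orthonormal for the semicircle law on `[-2, 2]`. -/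
def chebForm {n : ℕ} (m : ℕ) (A : Matrix (Fin (n + 1)) (Fin (n + 1)) ℝ) : ℝ :=
  theta A ⬝ᵥ
    (Polynomial.aeval ((√(n : ℝ))⁻¹ • minor A) (Polynomial.Chebyshev.S ℝ (m : ℤ)) *ᵥ theta A)

/-- The approximate diagonal entries. Here and below the index `k` starts at `0`, so that
`aTilde k` is the `(k+1)`-st entry `ã_{k+1}`: `ã₁ = M₁₁` and, for `k ≥ 1`,
`ã_{k+1} = √n θᵀ P_{2k-1}(M̃ / √n) θ`. -/
def aTilde {n : ℕ} (k : ℕ) (A : Matrix (Fin (n + 1)) (Fin (n + 1)) ℝ) : ℝ :=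
  if k = 0 then A 0 0 else √(n : ℝ) * chebForm (2 * k - 1) A

/-- The squares of the approximate off-diagonal entries; `bTildeSq k` is `b̃_{k+1}²`:
`b̃₁² = n ‖θ‖²` and, for `k ≥ 1`, `b̃_{k+1}² = n + n θᵀ P_{2k}(M̃ / √n) θ`. -/
def bTildeSq {n : ℕ} (k : ℕ) (A : Matrix (Fin (n + 1)) (Fin (n + 1)) ℝ) : ℝ :=
  if k = 0 then n * (theta A ⬝ᵥ theta A) else n + n * chebForm (2 * k) A

/-- `(b̃_{k+1}² - n) / √n`. -/
def bScaled {n : ℕ} (k : ℕ) (A : Matrix (Fin (n + 1)) (Fin (n + 1)) ℝ) : ℝ :=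
  (bTildeSq k A - n) / √(n : ℝ)

/-- The vector `Ẽ_n = (ã₁, …, ã_K, (b̃₁² - n)/√n, …, (b̃_K² - n)/√n)`. -/
def eTilde {n : ℕ} (K : ℕ) (A : Matrix (Fin (n + 1)) (Fin (n + 1)) ℝ) : Fin K ⊕ Fin K → ℝ :=
  Sum.elim (fun k => aTilde (k : ℕ) A) (fun k => bScaled (k : ℕ) A)

/-- The rate `2κ - 1` of the limit of the diagonal entry number `κ = k + 1`. -/
def rateA (k : ℕ) : ℝ := 2 * ((k : ℝ) + 1) - 1

/-- The rate `2κ` of the limit of the off-diagonal entry number `κ = k + 1`. -/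
def rateB (k : ℕ) : ℝ := 2 * ((k : ℝ) + 1)

/-- The pair partitions of `Fin j`; a pair partition is encoded as the involution without fixed
points that exchanges the two elements of each block. -/
def pairings (j : ℕ) : Finset (Equiv.Perm (Fin j)) :=
  Finset.univ.filter fun π => ∀ i, π i ≠ i ∧ π (π i) = i

/-- The Wick sum `2^{j/2} ∑_π ∏_{(i₁,i₂) ∈ π} δ_{k(i₁),k(i₂)} exp(-r(k(i₁)) |t(i₁) - t(i₂)|)` over
the pair partitions of `Fin j`; a block is listed by its smaller element. -/
def wickSum (r : ℕ → ℝ) {j : ℕ} (k : Fin j → ℕ) (t : Fin j → ℝ≥0) : ℝ :=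
  √2 ^ j * ∑ π ∈ pairings j, ∏ i ∈ Finset.univ.filter (fun i => i < π i),
    if k i = k (π i) then Real.exp (-(r (k i) * |(t i : ℝ) - (t (π i) : ℝ)|)) else 0

end TridiagGOE

end

/-! Everything in the statement is a polynomial in jointly Gaussian matrix entries at finitely many
times, so all moments are governed by Gaussian integration by parts (`isGaussianFunctional_expect`).
An index `i` stands for one factor with its time, and `ρ i j = exp(-|t_j - t_i|)`.

Three kinds of observables suffice: the corner entry, the centered forms `√n (θ_iᵀ W θ_j - mean)`,
and the centered traces `Tr W - n τ(w)`. Here `W` is a word in the normalized minors and `τ` is the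
joint moment functional of free semicircular variables with covariance `ρ`. Integrating by parts in
the corner, the column or the minor gives Schwinger--Dyson equations (`schwingerDyson_diag`,
`schwingerDyson_quad`, `schwingerDyson_tr`) that close on polynomials in these observables, with
coefficients polynomial in `n^{-1/2}`. Each equation trades a monomial for lighter ones, so all
mixed moments are bounded uniformly in `n` and in the times (`tight_tr`, `tight_lprod_atom`).

Bounded moments turn the equation for a form into an approximate Gaussian one: multiplication by the
form acts as a derivation with constant values on the generators, up to `O(n^{-1/2})`
(`asymptotic_ibp_quad`). The trace of the minor is no obstacle, because its fluctuations are `O(1)`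
and enter with a factor `n^{-1/2}`. Pairing off one factor at a time yields the Wick sum with the
same error (`wick_asymptotic`).

The limiting covariance of the forms of `f` and `g` consists of two contractions of the columns,
each worth `ρ² τ(f(x_i) g(x_j))`. Since `τ(P_m(x_i) P_l(x_j)) = δ_{ml} ρ^m` (`tauBilin_chebyshev`),
the Chebyshev forms decouple and have covariance `2 ρ^{m+2}`. The corner has covariance `2 ρ`; all
the rates `1, 2, 3, ...` thus appear once.

For the finite-dimensional distributions, the same Wick calculus with zero error gives the moments
of the limit. Their even moments grow slowly enough for a Taylor expansion of the characteristic
function, and Lévy's theorem concludes (`tendstoInDistribution_of_moments`). -/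

namespace TridiagGOE

/-! ### Gaussian integration by parts for polynomials -/

section IntegrationByParts

open MvPolynomial

/-- The derivation `p ↦ ∑ u, c v u * ∂p/∂X_u` of Gaussian integration by parts. -/
noncomputable def gaussDeriv {σ : Type*} (c : σ → σ → ℝ) (v : σ) :
    Derivation ℝ (MvPolynomial σ ℝ) (MvPolynomial σ ℝ) :=
  mkDerivation ℝ fun u => C (c v u)

@[simp]
lemma gaussDeriv_X {σ : Type*} (c : σ → σ → ℝ) (v u : σ) :
    gaussDeriv c v (X u) = C (c v u) := by
  simp [gaussDeriv]

/-- A linear functional on polynomials that satisfies Gaussian integration by parts. -/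
structure IsGaussianFunctional {σ : Type*} (c : σ → σ → ℝ) (E : MvPolynomial σ ℝ →ₗ[ℝ] ℝ) :
    Prop where
  map_one : E 1 = 1
  ibp : ∀ v p, E (X v * p) = E (gaussDeriv c v p)

/-- Derivations along a substitution are determined by the generators. This moves a derivation in
the matrix entries to the polynomial ring in the observables, where powers of `n^{-1/2}` and weights
are visible. -/
lemma derivation_aeval {σ B : Type*} [CommRing B] [Algebra ℝ B] (Z : σ → B)
    (D : Derivation ℝ (MvPolynomial σ ℝ) (MvPolynomial σ ℝ)) (D' : Derivation ℝ B B)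
    (h : ∀ a, D' (Z a) = aeval Z (D (X a))) (p : MvPolynomial σ ℝ) :
    D' (aeval Z p) = aeval Z (D p) := by
  induction p using MvPolynomial.induction_on with
  | C a => simp
  | add p q hp hq => simp [hp, hq]
  | mul_X p i hp => simp [Derivation.leibniz, hp, h]

/-- Hölder with exponents `2q`, `2q`: having moments of all orders is stable under products, hence
under polynomials. -/
lemma memLp_all_mul {Ω : Type*} [MeasurableSpace Ω] {P : Measure Ω} {f g : Ω → ℝ}
    (hf : ∀ q : ℕ, MemLp f q P) (hg : ∀ q : ℕ, MemLp g q P) (q : ℕ) :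
    MemLp (fun ω => f ω * g ω) q P := by
  have : ENNReal.HolderTriple ((2 * q : ℕ) : ENNReal) ((2 * q : ℕ) : ENNReal) (q : ENNReal) := by
    constructor
    rcases Nat.eq_zero_or_pos q with rfl | hq
    · simp
    · push_cast
      rw [ENNReal.mul_inv (by simp) (by simp), ← add_mul, ENNReal.inv_two_add_inv_two, one_mul]
  exact (hg (2 * q)).mul (hf (2 * q))

lemma memLp_eval {Ω T : Type*} [MeasurableSpace Ω] {P : Measure Ω} [IsFiniteMeasure P]
    {X : T → Ω → ℝ} (hX : ∀ t (q : ℕ), MemLp (X t) q P) (p : MvPolynomial T ℝ) (q : ℕ) :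
    MemLp (fun ω => eval (fun t => X t ω) p) q P := by
  induction p using MvPolynomial.induction_on generalizing q with
  | C a => simpa using memLp_const a
  | add p₁ p₂ h₁ h₂ => simpa using! (h₁ q).add (h₂ q)
  | mul_X p i hp => simpa using memLp_all_mul hp (hX i) q

lemma integrable_eval {Ω T : Type*} [MeasurableSpace Ω] {P : Measure Ω}
    {X : T → Ω → ℝ} (hX : IsGaussianProcess X P) (p : MvPolynomial T ℝ) :
    Integrable (fun ω => eval (fun t => X t ω) p) P := by
  have := hX.isProbabilityMeasure
  have h := memLp_eval (fun t q => (hX.hasGaussianLaw_eval t).memLp (by simp)) p 1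
  rw [Nat.cast_one] at h
  exact memLp_one_iff_integrable.1 h

/-- The expectation of polynomials in the values of a Gaussian process. -/
noncomputable def expect {Ω T : Type*} [MeasurableSpace Ω] {P : Measure Ω}
    {X : T → Ω → ℝ} (hX : IsGaussianProcess X P) : MvPolynomial T ℝ →ₗ[ℝ] ℝ where
  toFun p := ∫ ω, eval (fun t => X t ω) p ∂P
  map_add' p q := by
    simp only [map_add]
    exact integral_add (integrable_eval hX p) (integrable_eval hX q)
  map_smul' r p := by
    simp only [smul_eval, RingHom.id_apply, smul_eq_mul]
    exact integral_const_mul r _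

lemma integrable_polynomial_gaussianReal (v : ℝ≥0) (p : Polynomial ℝ) :
    Integrable (fun x => p.eval x) (gaussianReal 0 v) := by
  induction p using Polynomial.induction_on' with
  | add p q hp hq => simpa using! hp.add hq
  | monomial n a =>
    simp only [Polynomial.eval_monomial]
    refine Integrable.const_mul ?_ a
    have h := (memLp_id_gaussianReal (μ := 0) (v := v) n).integrable_norm_pow'
    rw [← integrable_norm_iff (by fun_prop)]
    simpa using h

lemma hasDerivAt_gaussianPDFReal {v : ℝ≥0} (hv : v ≠ 0) (x : ℝ) :
    HasDerivAt (gaussianPDFReal 0 v) (-(x * gaussianPDFReal 0 v x) / v) x := by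
  have hv' : (v : ℝ) ≠ 0 := by simpa using hv
  have h : HasDerivAt (fun x : ℝ => -(x - 0) ^ 2 / (2 * (v : ℝ))) (-(x / v)) x := by
    have := (((hasDerivAt_id x).sub_const 0).pow 2).neg.div_const (2 * (v : ℝ))
    convert! this using 1
    simp
    field_simp
  have := h.exp.const_mul (√(2 * Real.pi * v))⁻¹
  convert! this using 1
  rw [gaussianPDFReal_def]
  ring

/-- Stein's identity for polynomials in a centered real Gaussian variable. -/
lemma integral_mul_polynomial_gaussianReal (v : ℝ≥0) (p : Polynomial ℝ) :
    ∫ x, x * p.eval x ∂gaussianReal 0 v = v * ∫ x, p.derivative.eval x ∂gaussianReal 0 v := by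
  by_cases hv : v = 0
  · simp [hv]
  have hv' : (v : ℝ) ≠ 0 := by simpa using hv
  have hint : ∀ q : Polynomial ℝ, Integrable (fun x => q.eval x * gaussianPDFReal 0 v x) := by
    intro q
    have h := integrable_polynomial_gaussianReal v q
    rw [gaussianReal_of_var_ne_zero _ hv, integrable_withDensity_iff_integrable_smul₀'
      (by fun_prop) (by simp [gaussianPDF_lt_top])] at h
    refine h.congr (.of_forall fun x => ?_)
    simp [toReal_gaussianPDF, mul_comm]
  rw [integral_gaussianReal_eq_integral_smul hv, integral_gaussianReal_eq_integral_smul hv]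
  -- Ordinary integration by parts against the density `φ`, which satisfies `φ'(x) = -x φ(x) / v`.
  have key := integral_mul_deriv_eq_deriv_mul_of_integrable
    (u := fun x => p.eval x) (u' := fun x => p.derivative.eval x)
    (v := gaussianPDFReal 0 v) (v' := fun x => -(x * gaussianPDFReal 0 v x) / v)
    (fun x _ => p.hasDerivAt x) (fun x _ => hasDerivAt_gaussianPDFReal hv x)
    ((((hint (Polynomial.X * p)).neg).div_const (v : ℝ)).congr (.of_forall fun x => by
      simp; ring)) (hint _) (hint _)
  have h1 : ∫ x, gaussianPDFReal 0 v x • (x * p.eval x) =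
      -v * ∫ x, p.eval x * (-(x * gaussianPDFReal 0 v x) / v) := by
    rw [← integral_const_mul]
    congr 1 with x
    field_simp
    simp
    ring
  rw [h1, key]
  simp only [smul_eq_mul, mul_comm]
  ring

/-- The regression coefficient is usable even for a degenerate `X v`: then `X v = 0` almost surely,
so all its covariances vanish and the quotient by zero does no harm. -/
lemma covariance_factor {Ω T : Type*} [MeasurableSpace Ω] {P : Measure Ω} {X : T → Ω → ℝ}
    (hX : IsGaussianProcess X P) (v u : T) :
    (∫ ω, X v ω * X v ω ∂P) * ((∫ ω, X v ω * X u ω ∂P) / ∫ ω, X v ω * X v ω ∂P) =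
      ∫ ω, X v ω * X u ω ∂P := by
  by_cases h : ∫ ω, X v ω * X v ω ∂P = 0
  · have hm := (hX.hasGaussianLaw_eval v).memLp_two
    have h0 : (fun ω => X v ω * X v ω) =ᵐ[P] 0 :=
      (integral_eq_zero_iff_of_nonneg (fun ω => mul_self_nonneg _) (hm.integrable_mul hm)).1 h
    have h1 : (fun ω => X v ω * X u ω) =ᵐ[P] 0 := by
      filter_upwards [h0] with ω hω
      have : X v ω = 0 := by simpa using hω
      simp [this]
    rw [integral_congr_ae h1]
    simp [h]
  · rw [mul_comm, div_mul_cancel₀ _ h]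

/-- The regression of a Gaussian process on one of its values. -/
lemma indepFun_regression {Ω T : Type*} [MeasurableSpace Ω] {P : Measure Ω} {X : T → Ω → ℝ}
    (hX : IsGaussianProcess X P) (h0 : ∀ t, ∫ ω, X t ω ∂P = 0) (v : T) (a : T → ℝ)
    (ha : ∀ u, (∫ ω, X v ω * X v ω ∂P) * a u = ∫ ω, X v ω * X u ω ∂P) :
    IndepFun (X v) (fun ω u => X u ω - a u * X v ω) P := by
  classical
  have := hX.isProbabilityMeasure
  have hm : ∀ t, MemLp (X t) 2 P := fun t => (hX.hasGaussianLaw_eval t).memLp_two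
  have hR : ∀ u, MemLp (fun ω => X u ω - a u * X v ω) 2 P :=
    fun u => (hm u).sub ((hm v).const_mul (a u))
  have hproc : IsGaussianProcess (Sum.elim (fun _ : Unit => X v)
      (fun u ω => X u ω - a u * X v ω)) P := by
    refine hX.of_isGaussianProcess fun s => ?_
    rcases s with _ | u
    · exact ⟨{v}, .proj ⟨v, by simp⟩, by simp⟩
    · exact ⟨{u, v}, .proj ⟨u, by simp⟩ - a u • .proj ⟨v, by simp⟩, by simp⟩
  have hind := hproc.indepFun_of_covariance_eq_zero (fun _ => hX.aemeasurable v)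
    (fun u => (hR u).aemeasurable) (fun _ u => ?_)
  · exact hind.comp (φ := fun f : Unit → ℝ => f ()) (ψ := id) (measurable_pi_apply _) measurable_id
  · rw [covariance_eq_sub (hm v) (hR u)]
    have e : ∀ ω, (X v * fun ω => X u ω - a u * X v ω) ω =
        X v ω * X u ω - a u * (X v ω * X v ω) := fun ω => by simp; ring
    simp_rw [e]
    have i1 : Integrable (fun ω => X v ω * X u ω) P := (hm v).integrable_mul (hm u)
    have i2 : Integrable (fun ω => X v ω * X v ω) P := (hm v).integrable_mul (hm v)
    rw [integral_sub i1 (i2.const_mul _), integral_const_mul, h0, ← ha u]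
    ring

/-- Integration by parts: the expectation of polynomials in the values of a centered Gaussian
process is a Gaussian functional. -/
theorem isGaussianFunctional_expect {Ω T : Type*} [MeasurableSpace Ω] [Countable T]
    {P : Measure Ω} {X : T → Ω → ℝ} (hX : IsGaussianProcess X P)
    (h0 : ∀ t, ∫ ω, X t ω ∂P = 0) (c : T → T → ℝ) (hc : ∀ s t, ∫ ω, X s ω * X t ω ∂P = c s t) :
    IsGaussianFunctional c (expect hX) := by
  have := hX.isProbabilityMeasure
  refine ⟨by simp [expect], fun v p => ?_⟩
  set a : T → ℝ := fun u => c v u / c v v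
  have ha : ∀ u, c v v * a u = c v u := fun u => by
    simpa only [hc] using covariance_factor hX v u
  have hind := indepFun_regression hX h0 v a (by simpa only [hc] using ha)
  have hmv : AEMeasurable (X v) P := hX.aemeasurable v
  have hmR : AEMeasurable (fun ω u => X u ω - a u * X v ω) P :=
    aemeasurable_pi_lambda _ fun u => (hX.aemeasurable u).sub (hmv.const_mul _)
  set ν := P.map (fun ω u => X u ω - a u * X v ω)
  have hlaw : P.map (X v) = gaussianReal 0 (c v v).toNNReal := by
    rw [(hX.hasGaussianLaw_eval v).map_eq_gaussianReal, h0, variance_eq_sub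
      (hX.hasGaussianLaw_eval v).memLp_two, h0]
    congr 2
    rw [← hc v v]
    simp [pow_two]
  have hvv : 0 ≤ c v v := by
    rw [← hc]; exact integral_nonneg fun ω => mul_self_nonneg _
  have hpair : P.map (fun ω => (X v ω, fun u => X u ω - a u * X v ω)) =
      (gaussianReal 0 (c v v).toNNReal).prod ν := by
    rw [← hlaw]; exact (indepFun_iff_map_prod_eq_prod_map_map hmv hmR).1 hind
  have : IsProbabilityMeasure ν := Measure.isProbabilityMeasure_map hmR
  -- `X v` is independent of the residuals of the regression on it, so Fubini reduces the claim to
  -- Stein's identity in `X v` with the residuals frozen at `r`.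
  have hfub : ∀ h : ℝ × (T → ℝ) → ℝ, Measurable h → ∀ q : MvPolynomial T ℝ,
      (∀ ω, h (X v ω, fun u => X u ω - a u * X v ω) = eval (fun t => X t ω) q) →
      expect hX q = ∫ r, ∫ x, h (x, r) ∂gaussianReal 0 (c v v).toNNReal ∂ν := by
    intro h hh q hq
    have hi : Integrable h ((gaussianReal 0 (c v v).toNNReal).prod ν) := by
      rw [← hpair, integrable_map_measure hh.aestronglyMeasurable (hmv.prodMk hmR)]
      exact (integrable_eval hX q).congr (.of_forall fun ω => (hq ω).symm)
    rw [← integral_prod_symm _ hi, ← hpair,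
      integral_map (hmv.prodMk hmR) hh.aestronglyMeasurable]
    exact integral_congr_ae (.of_forall fun ω => (hq ω).symm)
  have hmeas : ∀ q : MvPolynomial T ℝ,
      Measurable fun z : ℝ × (T → ℝ) => eval (fun u => a u * z.1 + z.2 u) q := fun q =>
    (MvPolynomial.continuous_eval q).measurable.comp (by fun_prop)
  rw [hfub (fun z => z.1 * eval (fun u => a u * z.1 + z.2 u) p) (measurable_fst.mul (hmeas p))
      _ (fun ω => by simp),
    hfub (fun z => eval (fun u => a u * z.1 + z.2 u) (gaussDeriv c v p)) (hmeas _)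
      _ (fun ω => by simp)]
  congr 1 with r
  let Z : T → Polynomial ℝ := fun u => Polynomial.C (a u) * Polynomial.X + Polynomial.C (r u)
  have hZ : ∀ (q : MvPolynomial T ℝ) (x : ℝ),
      eval (fun u => a u * x + r u) q = (aeval Z q).eval x := by
    intro q x
    induction q using MvPolynomial.induction_on with
    | C b => simp
    | add p q hp hq => simp [hp, hq]
    | mul_X p i hp => simp [hp, Z]
  -- On the line `u ↦ a u * x + r u`, the derivation `gaussDeriv c v` is `c v v` times `d/dx`,
  -- because `c v v * a u = c v u`.
  have hD := derivation_aeval Z (gaussDeriv c v) (c v v • Polynomial.derivative') (fun u => by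
    simp [Z, Polynomial.derivative'_apply, Polynomial.smul_eq_C_mul, ← ha u]) p
  simp only [hZ]
  rw [integral_mul_polynomial_gaussianReal, ← hD, Real.coe_toNNReal _ hvv, ← integral_const_mul]
  simp [Polynomial.derivative'_apply]

end IntegrationByParts

/-! ### Pair partitions and the Wick formula -/

section Wick

/-- The Wick sum over the pair partitions of `Fin j` for the covariance `c`. -/
def wickFin {j : ℕ} (c : Fin j → Fin j → ℝ) : ℝ :=
  ∑ π ∈ pairings j, ∏ i ∈ Finset.univ.filter (fun i => i < π i), c i (π i)

lemma mem_pairings {j : ℕ} {π : Equiv.Perm (Fin j)} :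
    π ∈ pairings j ↔ ∀ i, π i ≠ i ∧ π (π i) = i := by
  simp [pairings]

lemma wickFin_zero (c : Fin 0 → Fin 0 → ℝ) : wickFin c = 1 := by
  have : pairings 0 = {1} := by
    ext π
    simp [mem_pairings, Subsingleton.elim π 1]
  simp [wickFin, this]

lemma wickFin_one (c : Fin 1 → Fin 1 → ℝ) : wickFin c = 0 := by
  have : pairings 1 = ∅ := by
    ext π
    simp [mem_pairings, Subsingleton.elim (π 0) 0]
  simp [wickFin, this]

/-- The embedding of `Fin j` onto the complement of `{0, p + 1}`. -/
def skipPair {j : ℕ} (p : Fin (j + 1)) : Fin j ↪ Fin (j + 2) :=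
  ⟨fun a => (p.succAbove a).succ, fun a b h => by simpa using h⟩

lemma skipPair_cases {j : ℕ} (p : Fin (j + 1)) (x : Fin (j + 2)) :
    x = 0 ∨ x = p.succ ∨ ∃ a, x = skipPair p a := by
  induction x using Fin.cases with
  | zero => simp
  | succ x =>
    rcases Fin.eq_self_or_eq_succAbove p x with h | ⟨a, h⟩
    · simp [h]
    · exact Or.inr (Or.inr ⟨a, congrArg Fin.succ h⟩)

lemma zero_notMem_range_skipPair {j : ℕ} (p : Fin (j + 1)) : 0 ∉ Set.range (skipPair p) := by
  rintro ⟨a, ha⟩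
  exact absurd ha (Fin.succ_ne_zero _)

lemma succ_notMem_range_skipPair {j : ℕ} (p : Fin (j + 1)) :
    p.succ ∉ Set.range (skipPair p) := by
  rintro ⟨a, ha⟩
  exact absurd (Fin.succ_injective _ ha) (Fin.succAbove_ne p a)

/-- The pair partition with the block `{0, p + 1}` and the blocks of `σ` on the other points. -/
noncomputable def addPair {j : ℕ} (p : Fin (j + 1)) (σ : Equiv.Perm (Fin j)) :
    Equiv.Perm (Fin (j + 2)) :=
  Equiv.swap 0 p.succ * σ.viaEmbedding (skipPair p)

lemma addPair_zero {j : ℕ} (p : Fin (j + 1)) (σ : Equiv.Perm (Fin j)) :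
    addPair p σ 0 = p.succ := by
  simp [addPair, Equiv.Perm.viaEmbedding_apply_of_notMem _ _ _ (zero_notMem_range_skipPair p)]

lemma addPair_succ {j : ℕ} (p : Fin (j + 1)) (σ : Equiv.Perm (Fin j)) :
    addPair p σ p.succ = 0 := by
  simp [addPair, Equiv.Perm.viaEmbedding_apply_of_notMem _ _ _ (succ_notMem_range_skipPair p)]

lemma addPair_skipPair {j : ℕ} (p : Fin (j + 1)) (σ : Equiv.Perm (Fin j)) (a : Fin j) :
    addPair p σ (skipPair p a) = skipPair p (σ a) := by
  rw [addPair, Equiv.Perm.mul_apply, Equiv.Perm.viaEmbedding_apply]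
  refine Equiv.swap_apply_of_ne_of_ne ?_ ?_
  · exact fun h => zero_notMem_range_skipPair p ⟨_, h⟩
  · exact fun h => succ_notMem_range_skipPair p ⟨_, h⟩

lemma skipPair_lt {j : ℕ} (p : Fin (j + 1)) (a b : Fin j) :
    skipPair p a < skipPair p b ↔ a < b := by
  change (p.succAbove a).succ < (p.succAbove b).succ ↔ a < b
  simp

/-- The block `{0, p + 1}` is listed at `0` only, and `skipPair p` is increasing, so the other
blocks keep their smaller elements. -/
lemma prod_addPair {j : ℕ} (c : Fin (j + 2) → Fin (j + 2) → ℝ) (p : Fin (j + 1))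
    (σ : Equiv.Perm (Fin j)) :
    ∏ i ∈ Finset.univ.filter (fun i => i < addPair p σ i), c i (addPair p σ i) =
      c 0 p.succ * ∏ i ∈ Finset.univ.filter (fun i => i < σ i),
        c (skipPair p i) (skipPair p (σ i)) := by
  rw [Finset.prod_filter, Finset.prod_filter, Fin.prod_univ_succ, Fin.prod_univ_succAbove _ p,
    addPair_zero, addPair_succ, if_pos (Fin.succ_pos p), if_neg (by simp), one_mul]
  congr 1
  refine Finset.prod_congr rfl fun a _ => ?_
  change (if skipPair p a < addPair p σ (skipPair p a) then
    c (skipPair p a) (addPair p σ (skipPair p a)) else 1) = _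
  rw [addPair_skipPair]
  simp only [skipPair_lt]

lemma addPair_mem {j : ℕ} (p : Fin (j + 1)) {σ : Equiv.Perm (Fin j)} (hσ : σ ∈ pairings j) :
    addPair p σ ∈ pairings (j + 2) := by
  rw [mem_pairings] at hσ ⊢
  intro x
  rcases skipPair_cases p x with rfl | rfl | ⟨a, rfl⟩
  · simp [addPair_zero, addPair_succ, Fin.succ_ne_zero]
  · simp [addPair_zero, addPair_succ, (Fin.succ_ne_zero _).symm]
  · simp [addPair_skipPair, hσ a]

/-- Read off the partner `p + 1` of `0`; as an involution, `π` preserves the complement of this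
block and restricts to a pairing there. -/
lemma exists_addPair {j : ℕ} {π : Equiv.Perm (Fin (j + 2))} (hπ : π ∈ pairings (j + 2)) :
    ∃ (p : Fin (j + 1)) (σ : Equiv.Perm (Fin j)), σ ∈ pairings j ∧ addPair p σ = π := by
  rw [mem_pairings] at hπ
  obtain ⟨p, hp⟩ := Fin.exists_succ_eq.2 (hπ 0).1
  have hp' : π p.succ = 0 := by rw [hp]; exact (hπ 0).2
  have hr : ∀ x, π x ∈ Set.range (skipPair p) ↔ x ∈ Set.range (skipPair p) := by
    have key : ∀ x, x ∈ Set.range (skipPair p) → π x ∈ Set.range (skipPair p) := by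
      intro x hx
      rcases skipPair_cases p (π x) with h | h | ⟨a, h⟩
      · rw [← hp', π.apply_eq_iff_eq] at h
        exact absurd (h ▸ hx) (succ_notMem_range_skipPair p)
      · rw [hp, π.apply_eq_iff_eq] at h
        exact absurd (h ▸ hx) (zero_notMem_range_skipPair p)
      · exact ⟨a, h.symm⟩
    refine fun x => ⟨fun h => ?_, key x⟩
    have := key _ h
    rwa [(hπ x).2] at this
  let σ : Equiv.Perm (Fin j) :=
    (Equiv.ofInjective _ (skipPair p).injective).permCongr.symm (π.subtypePerm hr)
  have hσ : ∀ a, skipPair p (σ a) = π (skipPair p a) := by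
    intro a
    simp only [σ, Equiv.permCongr_symm_apply]
    rw [Equiv.apply_ofInjective_symm (skipPair p).injective]
    simp
  refine ⟨p, σ, ?_, ?_⟩
  · rw [mem_pairings]
    refine fun a => ⟨fun h => (hπ (skipPair p a)).1 ?_, (skipPair p).injective ?_⟩
    · rw [← hσ, h]
    · rw [hσ, hσ, (hπ _).2]
  · ext1 x
    rcases skipPair_cases p x with rfl | rfl | ⟨a, rfl⟩
    · rw [addPair_zero, hp]
    · rw [addPair_succ, hp']
    · rw [addPair_skipPair, hσ]

lemma addPair_injective {j : ℕ} {p q : Fin (j + 1)} {σ τ : Equiv.Perm (Fin j)}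
    (h : addPair p σ = addPair q τ) : p = q ∧ σ = τ := by
  have h0 : p = q := by
    have := congrArg (fun π => π 0) h
    simpa [addPair_zero] using this
  subst h0
  refine ⟨rfl, ?_⟩
  ext1 a
  have := congrArg (fun π => π (skipPair p a)) h
  simpa [addPair_skipPair] using this

/-- Classify the pairings by the partner of `0`. This recursion mirrors one integration by parts. -/
lemma wickFin_succ_succ {j : ℕ} (c : Fin (j + 2) → Fin (j + 2) → ℝ) :
    wickFin c = ∑ p : Fin (j + 1), c 0 p.succ *
      wickFin fun a b => c (skipPair p a) (skipPair p b) := by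
  simp only [wickFin, Finset.mul_sum]
  rw [← Finset.sum_product']
  symm
  refine Finset.sum_bij (fun x _ => addPair x.1 x.2) ?_ ?_ ?_ ?_
  · rintro ⟨p, σ⟩ hx
    exact addPair_mem p (by simpa using hx)
  · rintro ⟨p, σ⟩ - ⟨q, τ⟩ - h
    obtain ⟨rfl, rfl⟩ := addPair_injective h
    rfl
  · intro π hπ
    obtain ⟨p, σ, hσ, rfl⟩ := exists_addPair hπ
    exact ⟨(p, σ), by simpa using hσ, rfl⟩
  · rintro ⟨p, σ⟩ -
    exact (prod_addPair c p σ).symm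

/-- The prefactor `2^{j/2}` gives one factor `2` to each of the `j/2` blocks; for odd `j` there are
no pairings and both sides vanish. -/
lemma wickSum_eq_wickFin (r : ℕ → ℝ) {j : ℕ} (k : Fin j → ℕ) (t : Fin j → ℝ≥0) :
    wickSum r k t = wickFin fun a b =>
      2 * if k a = k b then Real.exp (-(r (k a) * |(t a : ℝ) - (t b : ℝ)|)) else 0 := by
  induction j using Nat.strong_induction_on with
  | _ j ih =>
    have hs : ∀ (i : ℕ) (k : Fin i → ℕ) (t : Fin i → ℝ≥0), wickSum r k t = √2 ^ i *
        wickFin fun a b =>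
          if k a = k b then Real.exp (-(r (k a) * |(t a : ℝ) - (t b : ℝ)|)) else 0 :=
      fun _ _ _ => rfl
    match j with
    | 0 => rw [hs, wickFin_zero, wickFin_zero]; simp
    | 1 => rw [hs, wickFin_one, wickFin_one]; simp
    | j + 2 =>
      rw [hs, wickFin_succ_succ, wickFin_succ_succ, Finset.mul_sum]
      refine Finset.sum_congr rfl fun p _ => ?_
      have := ih j (by omega) (fun a => k (skipPair p a)) (fun a => t (skipPair p a))
      rw [← this, hs, pow_add, Real.sq_sqrt (by norm_num)]
      ring

lemma derivation_prod_fin {A : Type*} [CommRing A] [Algebra ℝ A] (D : Derivation ℝ A A) {j : ℕ}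
    (g : Fin (j + 1) → A) :
    D (∏ i, g i) = ∑ p, (∏ i, g (p.succAbove i)) * D (g p) := by
  induction j with
  | zero => simp
  | succ j ih =>
    rw [Fin.prod_univ_succ, D.leibniz, ih, Fin.sum_univ_succ (n := j + 1), add_comm, smul_eq_mul, smul_eq_mul,
      Finset.mul_sum]
    congr 1
    refine Finset.sum_congr rfl fun p _ => ?_
    rw [Fin.prod_univ_succ]
    simp [Fin.succ_succAbove_succ, mul_assoc]

/-- If `F x` satisfies integration by parts for the family `Y` up to an error of order `ε x`, then
its values on products are the Wick sums up to an error of the same order. -/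
theorem wick_asymptotic {Θ S A : Type*} [CommRing A] [Algebra ℝ A] (F : Θ → A →ₗ[ℝ] ℝ)
    (Y : S → A) (c : Θ → S → S → ℝ) (D : Θ → S → Derivation ℝ A A) (ε : Θ → ℝ)
    (hD : ∀ x s s', D x s (Y s') = algebraMap ℝ A (c x s s'))
    (hF : ∀ s p, ∃ C, ∀ x, |F x (Y s * p) - F x (D x s p)| ≤ C * ε x)
    (hc : ∀ s s', ∃ C, ∀ x, |c x s s'| ≤ C) (G : A) (j : ℕ) (f : Fin j → S)
    (hG : ∀ i x, D x (f i) G = 0) :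
    ∃ C, ∀ x, |F x ((∏ i, Y (f i)) * G) - wickFin (fun a b => c x (f a) (f b)) * F x G| ≤
      C * ε x := by
  induction j using Nat.strong_induction_on with
  | _ j ih =>
    match j with
    | 0 => exact ⟨0, fun x => by simp [wickFin_zero]⟩
    | 1 =>
      obtain ⟨C, hC⟩ := hF (f 0) G
      refine ⟨C, fun x => ?_⟩
      simpa [wickFin_one, hG] using hC x
    | j + 2 =>
      obtain ⟨C₀, hC₀⟩ := hF (f 0) ((∏ i : Fin (j + 1), Y (f i.succ)) * G)
      choose C hC using fun p : Fin (j + 1) => ih j (by omega) (fun a => f (skipPair p a))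
        (fun i x => hG _ x)
      choose K hK using fun p : Fin (j + 1) => hc (f 0) (f p.succ)
      refine ⟨C₀ + ∑ p, K p * C p, fun x => ?_⟩
      -- `G` is killed by the derivation, so Leibniz only replaces one factor at a time by its
      -- constant covariance with `Y (f 0)`.
      have e1 : F x (D x (f 0) ((∏ i : Fin (j + 1), Y (f i.succ)) * G)) =
          ∑ p : Fin (j + 1), c x (f 0) (f p.succ) * F x ((∏ i, Y (f (skipPair p i))) * G) := by
        rw [Derivation.leibniz, hG, smul_zero, zero_add, derivation_prod_fin, smul_eq_mul,
          Finset.mul_sum, map_sum]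
        refine Finset.sum_congr rfl fun p _ => ?_
        rw [hD, ← smul_eq_mul (c x (f 0) (f p.succ)), ← map_smul, Algebra.smul_def]
        congr 1
        change G * ((∏ i, Y (f (skipPair p i))) * _) = _
        ring
      -- The error is that of one integration by parts plus the errors of the shorter products,
      -- weighted by bounded covariances.
      have e2 : F x ((∏ i, Y (f i)) * G) - wickFin (fun a b => c x (f a) (f b)) * F x G =
          (F x (Y (f 0) * ((∏ i : Fin (j + 1), Y (f i.succ)) * G)) -
            F x (D x (f 0) ((∏ i : Fin (j + 1), Y (f i.succ)) * G))) +
          ∑ p : Fin (j + 1), c x (f 0) (f p.succ) * (F x ((∏ i, Y (f (skipPair p i))) * G) -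
            wickFin (fun a b => c x (f (skipPair p a)) (f (skipPair p b))) * F x G) := by
        rw [e1, wickFin_succ_succ, Fin.prod_univ_succ, Finset.sum_mul, mul_assoc]
        simp only [mul_sub, Finset.sum_sub_distrib, mul_assoc]
        ring
      rw [e2, add_mul, Finset.sum_mul]
      refine (abs_add_le _ _).trans (add_le_add (hC₀ x) ?_)
      refine (Finset.abs_sum_le_sum_abs _ _).trans (Finset.sum_le_sum fun p _ => ?_)
      rw [abs_mul, mul_assoc]
      exact mul_le_mul (hK p x) (hC p x) (abs_nonneg _) ((abs_nonneg _).trans (hK p x))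

lemma wickFin_bounded {Θ S : Type*} (c : Θ → S → S → ℝ) (hc : ∀ s s', ∃ C, ∀ x, |c x s s'| ≤ C)
    {j : ℕ} (f : Fin j → S) : ∃ C, ∀ x, |wickFin fun a b => c x (f a) (f b)| ≤ C := by
  choose K hK using hc
  refine ⟨∑ π ∈ pairings j, ∏ i ∈ Finset.univ.filter (fun i => i < π i), K (f i) (f (π i)),
    fun x => (Finset.abs_sum_le_sum_abs _ _).trans (Finset.sum_le_sum fun π _ => ?_)⟩
  rw [Finset.abs_prod]
  exact Finset.prod_le_prod (fun _ _ => abs_nonneg _) fun i _ => hK _ _ x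

end Wick

/-! ### The semicircular functional on words -/

section Semicircular

/-- All ways `w = A ++ s :: B` to single out a letter `s` of the word `w`. -/
def splits {ι : Type*} : List ι → List (List ι × ι × List ι)
  | [] => []
  | s :: w => ([], s, w) :: (splits w).map fun x => (s :: x.1, x.2.1, x.2.2)

lemma eq_of_mem_splits {ι : Type*} {w : List ι} {x : List ι × ι × List ι} (hx : x ∈ splits w) :
    w = x.1 ++ x.2.1 :: x.2.2 := by
  induction w generalizing x with
  | nil => simp [splits] at hx
  | cons s w ih =>
    simp only [splits, List.mem_cons, List.mem_map] at hx
    rcases hx with rfl | ⟨y, hy, rfl⟩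
    · rfl
    · simpa using ih hy

lemma length_of_mem_splits {ι : Type*} {w : List ι} {x : List ι × ι × List ι}
    (hx : x ∈ splits w) : x.1.length + x.2.2.length + 1 = w.length := by
  rw [eq_of_mem_splits hx]
  simp
  omega

lemma splits_append {ι : Type*} (u v : List ι) :
    splits (u ++ v) = (splits u).map (fun x => (x.1, x.2.1, x.2.2 ++ v)) ++
      (splits v).map fun x => (u ++ x.1, x.2.1, x.2.2) := by
  induction u with
  | nil => simp [splits]
  | cons s u ih => simp [splits, ih, Function.comp_def]

lemma splits_replicate {ι : Type*} (a : ℕ) (i : ι) :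
    splits (List.replicate a i) =
      (List.range a).map fun k => (List.replicate k i, i, List.replicate (a - 1 - k) i) := by
  induction a with
  | zero => simp [splits]
  | succ a ih =>
    rw [List.replicate_succ, splits, ih, List.range_succ_eq_map]
    simp only [List.map_map, List.map_cons, List.replicate_zero]
    refine congrArg₂ _ (by simp) (List.map_congr_left fun k _ => ?_)
    simp [List.replicate_succ, Nat.sub_sub, add_comm]

/-- The joint moments of a free semicircular family with covariance `ρ`. -/
noncomputable def tau {ι : Type*} (ρ : ι → ι → ℝ) : List ι → ℝ
  | [] => 1
  -- The first letter is paired with a letter `s`; a noncrossing pairing then splits into one of the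
  -- word between them and one of the word after `s`.
  | i :: Q => ((splits Q).attach.map fun x =>
      ρ i x.1.2.1 * (tau ρ x.1.1 * tau ρ x.1.2.2)).sum
  termination_by w => w.length
  decreasing_by
    all_goals
      have := length_of_mem_splits x.2
      simp only [List.length_cons]
      omega

@[simp]
lemma tau_nil {ι : Type*} (ρ : ι → ι → ℝ) : tau ρ [] = 1 := by
  rw [tau]

lemma tau_cons {ι : Type*} (ρ : ι → ι → ℝ) (i : ι) (Q : List ι) :
    tau ρ (i :: Q) =
      ((splits Q).map fun x => ρ i x.2.1 * (tau ρ x.1 * tau ρ x.2.2)).sum := by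
  rw [tau, List.attach_map_val (f := fun x : List ι × ι × List ι =>
    ρ i x.2.1 * (tau ρ x.1 * tau ρ x.2.2))]

lemma bounded_list_sum {Θ α : Type*} (l : List α) (g : Θ → α → ℝ)
    (h : ∀ a ∈ l, ∃ C, ∀ x, |g x a| ≤ C) : ∃ C, ∀ x, |(l.map (g x)).sum| ≤ C := by
  induction l with
  | nil => exact ⟨0, fun x => by simp⟩
  | cons a l ih =>
    obtain ⟨C, hC⟩ := h a (by simp)
    obtain ⟨C', hC'⟩ := ih fun b hb => h b (by simp [hb])
    refine ⟨C + C', fun x => ?_⟩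
    rw [List.map_cons, List.sum_cons]
    exact (abs_add_le _ _).trans (add_le_add (hC x) (hC' x))

lemma bounded_mul {Θ : Type*} {f g : Θ → ℝ} (hf : ∃ C, ∀ x, |f x| ≤ C)
    (hg : ∃ C, ∀ x, |g x| ≤ C) : ∃ C, ∀ x, |f x * g x| ≤ C := by
  obtain ⟨C, hC⟩ := hf
  obtain ⟨C', hC'⟩ := hg
  refine ⟨C * C', fun x => ?_⟩
  rw [abs_mul]
  exact mul_le_mul (hC x) (hC' x) (abs_nonneg _) ((abs_nonneg _).trans (hC x))

lemma tau_bounded {Θ ι : Type*} (ρ : Θ → ι → ι → ℝ) (hρ : ∀ i j, ∃ C, ∀ x, |ρ x i j| ≤ C)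
    (w : List ι) : ∃ C, ∀ x, |tau (ρ x) w| ≤ C := by
  induction h : w.length using Nat.strong_induction_on generalizing w with
  | _ N ih =>
    cases w with
    | nil => exact ⟨1, fun x => by simp⟩
    | cons i Q =>
      simp only [tau_cons]
      refine bounded_list_sum _ (fun x (y : List ι × ι × List ι) => ρ x i y.2.1 * (tau (ρ x) y.1 * tau (ρ x) y.2.2))
        fun y hy => ?_
      have hl := length_of_mem_splits hy
      simp only [List.length_cons] at h
      exact bounded_mul (hρ _ _) (bounded_mul (ih _ (by omega) _ rfl) (ih _ (by omega) _ rfl))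

open Polynomial

/-- The moment functional of a single letter. -/
noncomputable def tauLin {ι : Type*} (ρ : ι → ι → ℝ) (i : ι) : ℝ[X] →ₗ[ℝ] ℝ :=
  (Polynomial.basisMonomials ℝ).constr ℝ fun k => tau ρ (List.replicate k i)

/-- The functional `(f, g) ↦ τ(f(x_i) g(x_j))`. -/
noncomputable def tauBilin {ι : Type*} (ρ : ι → ι → ℝ) (i j : ι) : ℝ[X] →ₗ[ℝ] ℝ[X] →ₗ[ℝ] ℝ :=
  (Polynomial.basisMonomials ℝ).constr ℝ fun a =>
    (Polynomial.basisMonomials ℝ).constr ℝ fun b =>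
      tau ρ (List.replicate a i ++ List.replicate b j)

/-- The free difference quotient, evaluated by `τ` in one of its two variables. -/
noncomputable def diffQuot {ι : Type*} (ρ : ι → ι → ℝ) (i : ι) : ℝ[X] →ₗ[ℝ] ℝ[X] :=
  (Polynomial.basisMonomials ℝ).constr ℝ fun a =>
    ∑ k ∈ Finset.range a, tau ρ (List.replicate k i) • X ^ (a - 1 - k)

lemma constr_X_pow {V : Type*} [AddCommGroup V] [Module ℝ V] (f : ℕ → V) (a : ℕ) :
    (Polynomial.basisMonomials ℝ).constr ℝ f (X ^ a) = f a := by
  have h : (X ^ a : ℝ[X]) = Polynomial.basisMonomials ℝ a := by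
    rw [X_pow_eq_monomial, Polynomial.coe_basisMonomials]
  rw [h, Module.Basis.constr_basis]

lemma polynomial_lin_ind {P : ℝ[X] → Prop} (hadd : ∀ f g, P f → P g → P (f + g))
    (hsmul : ∀ (r : ℝ) f, P f → P (r • f)) (hX : ∀ k, P (X ^ k)) (f : ℝ[X]) : P f := by
  induction f using Polynomial.induction_on' with
  | add f g hf hg => exact hadd f g hf hg
  | monomial n a =>
    rw [← C_mul_X_pow_eq_monomial, ← smul_eq_C_mul]
    exact hsmul a _ (hX n)

lemma tauLin_X_pow {ι : Type*} (ρ : ι → ι → ℝ) (i : ι) (k : ℕ) :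
    tauLin ρ i (X ^ k) = tau ρ (List.replicate k i) := constr_X_pow _ _

lemma tauBilin_X_pow {ι : Type*} (ρ : ι → ι → ℝ) (i j : ι) (a b : ℕ) :
    tauBilin ρ i j (X ^ a) (X ^ b) = tau ρ (List.replicate a i ++ List.replicate b j) := by
  rw [tauBilin, constr_X_pow, constr_X_pow]

lemma diffQuot_X_pow {ι : Type*} (ρ : ι → ι → ℝ) (i : ι) (a : ℕ) :
    diffQuot ρ i (X ^ a) =
      ∑ k ∈ Finset.range a, tau ρ (List.replicate k i) • X ^ (a - 1 - k) := constr_X_pow _ _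

lemma tauBilin_one_right {ι : Type*} (ρ : ι → ι → ℝ) (i j : ι) (f : ℝ[X]) :
    tauBilin ρ i j f 1 = tauLin ρ i f := by
  induction f using polynomial_lin_ind with
  | hadd f g hf hg => simp [hf, hg]
  | hsmul r f hf => simp [hf]
  | hX k => rw [← pow_zero X, tauBilin_X_pow, tauLin_X_pow]; simp

lemma tauBilin_one_left {ι : Type*} (ρ : ι → ι → ℝ) (i j : ι) (f : ℝ[X]) :
    tauBilin ρ i j 1 f = tauLin ρ j f := by
  induction f using polynomial_lin_ind with
  | hadd f g hf hg => simp [hf, hg]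
  | hsmul r f hf => simp [hf]
  | hX k => rw [← pow_zero X, tauBilin_X_pow, tauLin_X_pow]; simp

lemma diffQuot_one {ι : Type*} (ρ : ι → ι → ℝ) (i : ι) : diffQuot ρ i 1 = 0 := by
  rw [← pow_zero X, diffQuot_X_pow]
  simp

/-- Leibniz for the free difference quotient: the extra factor `X` either stays, or is itself
differentiated and leaves the moment of `f`. -/
lemma diffQuot_X_mul {ι : Type*} (ρ : ι → ι → ℝ) (i : ι) (f : ℝ[X]) :
    diffQuot ρ i (X * f) = X * diffQuot ρ i f + C (tauLin ρ i f) := by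
  induction f using polynomial_lin_ind with
  | hadd f g hf hg => simp only [mul_add, map_add, hf, hg]; ring
  | hsmul r f hf =>
    simp only [mul_smul_comm, map_smul, hf, smul_add, smul_eq_mul, C_mul]
    rw [smul_eq_C_mul, smul_eq_C_mul]
  | hX k =>
    rw [← pow_succ', diffQuot_X_pow, diffQuot_X_pow, tauLin_X_pow, Finset.sum_range_succ,
      Finset.mul_sum]
    congr 1
    · refine Finset.sum_congr rfl fun l hl => ?_
      have := Finset.mem_range.1 hl
      rw [mul_smul_comm, ← pow_succ']
      congr 2
      omega
    · simp [smul_eq_C_mul]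

/-- This is `tau_cons` for the word `i^{a+1} j^b`: the first letter is paired within the block of
`i` or with a letter of the block of `j`. -/
lemma tauBilin_X_mul {ι : Type*} (ρ : ι → ι → ℝ) (i j : ι) (hi : ρ i i = 1) (f g : ℝ[X]) :
    tauBilin ρ i j (X * f) g =
      tauBilin ρ i j (diffQuot ρ i f) g + ρ i j * tauBilin ρ i j f (diffQuot ρ j g) := by
  induction f using polynomial_lin_ind with
  | hadd f f' hf hf' => simp only [mul_add, map_add, LinearMap.add_apply, hf, hf']; ring
  | hsmul r f hf =>
    simp only [mul_smul_comm, map_smul, LinearMap.smul_apply, hf, smul_eq_mul]; ring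
  | hX a =>
    induction g using polynomial_lin_ind with
    | hadd f f' hf hf' => simp only [map_add, hf, hf']; ring
    | hsmul r f hf => simp only [map_smul, hf, smul_eq_mul]; ring
    | hX b =>
      rw [← pow_succ', tauBilin_X_pow, List.replicate_succ, List.cons_append, tau_cons,
        splits_append, splits_replicate, splits_replicate, diffQuot_X_pow, diffQuot_X_pow]
      simp only [List.map_append, List.map_map, List.sum_append, map_sum, map_smul,
        LinearMap.sum_apply, LinearMap.smul_apply, tauBilin_X_pow, smul_eq_mul]
      rw [Finset.mul_sum, ← List.sum_toFinset _ List.nodup_range,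
        ← List.sum_toFinset _ List.nodup_range, List.toFinset_range, List.toFinset_range]
      congr 1
      · simp [hi]
      -- Here the enclosed word keeps the beginning of the block `j^b`, whereas `diffQuot` evaluates
      -- the beginning and keeps the end; reversing the summation index matches the two.
      · rw [← Finset.sum_range_reflect]
        refine Finset.sum_congr rfl fun k hk => ?_
        have := Finset.mem_range.1 hk
        simp only [Function.comp_apply]
        rw [show b - 1 - (b - 1 - k) = k by omega]
        ring

-- Both claims are needed in one induction. In the recursion `P_{m+2} = X P_{m+1} - P_m` the
-- difference quotient produces the mean of `P_{m+1}`, which is zero; and the mean of `P_{m+2}` is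
-- that of `diffQuot P_{m+1} = P_m` minus that of `P_m`. For `m = 0` the convention `P_{-1} = 0`
-- applies.
open Polynomial.Chebyshev in
lemma chebyshev_diffQuot_tauLin {ι : Type*} (ρ : ι → ι → ℝ) (i : ι) (hi : ρ i i = 1) (m : ℕ) :
    (diffQuot ρ i (S ℝ (m : ℤ)) = S ℝ ((m : ℤ) - 1) ∧
      tauLin ρ i (S ℝ (m : ℤ)) = if m = 0 then 1 else 0) := by
  have hτ : ∀ f, tauLin ρ i (X * f) = tauLin ρ i (diffQuot ρ i f) := by
    intro f
    rw [← tauBilin_one_right ρ i i, tauBilin_X_mul ρ i i hi, diffQuot_one, tauBilin_one_right]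
    simp
  have h1 : tauLin ρ i 1 = 1 := by rw [← pow_zero X, tauLin_X_pow]; simp
  induction m using Nat.twoStepInduction with
  | zero => simp [diffQuot_one, h1]
  | one =>
    have h := diffQuot_X_mul ρ i 1
    have h' := hτ 1
    rw [mul_one, diffQuot_one] at h h'
    simp [h, h', h1]
  | more m ih₀ ih₁ =>
    have e : S ℝ ((m + 2 : ℕ) : ℤ) = X * S ℝ ((m + 1 : ℕ) : ℤ) - S ℝ (m : ℤ) := by
      push_cast; exact S_add_two ℝ m
    have e' : S ℝ (((m + 2 : ℕ) : ℤ) - 1) =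
        X * S ℝ (((m + 1 : ℕ) : ℤ) - 1) - S ℝ ((m : ℤ) - 1) := by
      have := S_add_two ℝ ((m : ℤ) - 1)
      push_cast
      ring_nf at this ⊢
      exact this
    constructor
    · rw [e, e', map_sub, diffQuot_X_mul, ih₀.1, ih₁.1, ih₁.2]
      simp
    · rw [e, map_sub, hτ, ih₁.1]
      push_cast
      simp

open Polynomial.Chebyshev in
/-- The Chebyshev polynomials are orthonormal for the semicircle law, and the covariance of
`P_m` and `P_m` in two semicircular variables of covariance `c` is `c ^ m`. -/
lemma tauBilin_chebyshev {ι : Type*} (ρ : ι → ι → ℝ) (i j : ι) (hi : ρ i i = 1)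
    (hj : ρ j j = 1) (m l : ℕ) :
    tauBilin ρ i j (S ℝ (m : ℤ)) (S ℝ (l : ℤ)) = if m = l then ρ i j ^ m else 0 := by
  induction m generalizing l with
  | zero =>
    rw [Nat.cast_zero, S_zero, tauBilin_one_left, (chebyshev_diffQuot_tauLin ρ j hj l).2]
    simp [eq_comm]
  | succ m ih =>
    have e : S ℝ ((m + 1 : ℕ) : ℤ) = X * S ℝ (m : ℤ) - S ℝ ((m : ℤ) - 1) := by
      have := S_add_two ℝ ((m : ℤ) - 1)
      push_cast
      ring_nf at this ⊢
      exact this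
    -- In `P_{m+1} = X P_m - P_{m-1}`, the difference quotient of `P_m` cancels the subtracted term,
    -- leaving `ρ i j τ(P_m(x_i) P_{l-1}(x_j))`: one factor of `ρ` per degree.
    rw [e, map_sub, LinearMap.sub_apply, tauBilin_X_mul ρ i j hi,
      (chebyshev_diffQuot_tauLin ρ i hi m).1, (chebyshev_diffQuot_tauLin ρ j hj l).1]
    cases l with
    | zero => simp
    | succ l =>
      have : ((l + 1 : ℕ) : ℤ) - 1 = l := by push_cast; ring
      rw [this, ih]
      by_cases h : m = l
      · simp [h, pow_succ']
      · simp [h]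

end Semicircular

/-! ### Schwinger--Dyson equations -/

section WordMatrices

variable {ι m R : Type*} [Fintype m] [CommRing R]

lemma map_derivation_mul [Algebra ℝ R] (D : Derivation ℝ R R) (A B : Matrix m m R) :
    (A * B).map D = A.map D * B + A * B.map D := by
  ext a b
  simp only [Matrix.map_apply, Matrix.mul_apply, map_sum, Derivation.leibniz, Matrix.add_apply,
    smul_eq_mul, Finset.sum_add_distrib]
  rw [add_comm]
  simp only [mul_comm]

variable [DecidableEq m]

/-- The product of the matrices `V i` along a word. -/
def word (V : ι → Matrix m m R) (w : List ι) : Matrix m m R := (w.map V).prod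

@[simp]
lemma word_nil (V : ι → Matrix m m R) : word V [] = 1 := by simp [word]

lemma word_cons (V : ι → Matrix m m R) (i : ι) (w : List ι) :
    word V (i :: w) = V i * word V w := by simp [word]

lemma word_append (V : ι → Matrix m m R) (u w : List ι) :
    word V (u ++ w) = word V u * word V w := by simp [word]

lemma word_transpose (V : ι → Matrix m m R) (hV : ∀ i, (V i)ᵀ = V i) (w : List ι) :
    (word V w)ᵀ = word V w.reverse := by
  induction w with
  | nil => simp
  | cons i w ih =>
    rw [word_cons, Matrix.transpose_mul, ih, hV, List.reverse_cons, word_append, word_cons]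
    simp

lemma mul_single_mul_apply (A B : Matrix m m R) (a b c d : m) :
    (A * Matrix.single a b (1 : R) * B) c d = A c a * B b d := by
  rw [Matrix.mul_apply, Finset.sum_eq_single b]
  · simp
  · intro e _ he
    rw [Matrix.mul_single_apply_of_ne _ _ _ _ _ he.symm.symm, zero_mul]
  · simp

variable [Algebra ℝ R]

lemma map_derivation_word (D : Derivation ℝ R R) (V : ι → Matrix m m R) (w : List ι) :
    (word V w).map D =
      ((splits w).map fun x => word V x.1 * (V x.2.1).map D * word V x.2.2).sum := by
  induction w with
  | nil =>
    ext a b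
    simp only [word_nil, splits, List.map_nil, List.sum_nil, Matrix.map_apply, Matrix.zero_apply,
      Matrix.one_apply]
    split_ifs <;> simp
  | cons i w ih =>
    rw [word_cons, map_derivation_mul, ih, splits, List.map_cons, List.sum_cons, List.map_map,
      ← List.sum_map_mul_left]
    simp [Function.comp_def, word_cons, mul_assoc]

/-- A family of derivations that acts on the matrices `V i` as the gradient of a symmetric
Gaussian matrix. -/
def IsMatrixGradient (V : ι → Matrix m m R) (D : m → m → Derivation ℝ R R) (r : ι → ℝ) : Prop :=
  ∀ a b i, (V i).map (D a b) = r i • (Matrix.single a b (1 : R) + Matrix.single b a (1 : R))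

lemma gradient_word_apply {V : ι → Matrix m m R} {D : m → m → Derivation ℝ R R} {r : ι → ℝ}
    (hD : IsMatrixGradient V D r) (w : List ι) (a b c d : m) :
    D a b (word V w c d) = ((splits w).map fun x => r x.2.1 •
      (word V x.1 c a * word V x.2.2 b d + word V x.1 c b * word V x.2.2 a d)).sum := by
  have h : D a b (word V w c d) = ((word V w).map (D a b)) c d := rfl
  rw [h, map_derivation_word]
  have happ : ∀ l : List (Matrix m m R), l.sum c d = (l.map fun M => M c d).sum := by
    intro l
    induction l with
    | nil => simp
    | cons M l ih => simp [ih]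
  rw [happ, List.map_map]
  congr 1
  refine List.map_congr_left fun x _ => ?_
  simp only [Function.comp_apply, hD a b]
  rw [Matrix.mul_smul, Matrix.smul_mul, Matrix.smul_apply, mul_add, add_mul, Matrix.add_apply,
    mul_single_mul_apply, mul_single_mul_apply]

lemma sum_list_sum {α β : Type*} {M : Type*} [AddCommMonoid M] (s : Finset β) (l : List α)
    (f : β → α → M) : ∑ b ∈ s, (l.map (f b)).sum = (l.map fun x => ∑ b ∈ s, f b x).sum := by
  induction l with
  | nil => simp
  | cons x l ih => simp [Finset.sum_add_distrib, ih]

/-- Of the two elementary matrices in the gradient, one cuts the word into a product of two traces.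
The other exists because the matrices are symmetric; it transposes the right part and leaves a
single trace, one order in `n` lower. -/
lemma sum_gradient_word {V : ι → Matrix m m R} {D : m → m → Derivation ℝ R R} {r : ι → ℝ}
    (hD : IsMatrixGradient V D r) (hV : ∀ i, (V i)ᵀ = V i) (w : List ι) :
    ∑ a, ∑ b, D a b (word V w b a) = ((splits w).map fun x => r x.2.1 •
      ((word V x.1).trace * (word V x.2.2).trace +
        (word V (x.1 ++ x.2.2.reverse)).trace)).sum := by
  simp only [gradient_word_apply hD, sum_list_sum]
  congr 1
  refine List.map_congr_left fun x _ => ?_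
  simp only [← Finset.smul_sum]
  congr 1
  rw [word_append, ← word_transpose V hV, Matrix.trace_mul_comm]
  simp only [Finset.sum_add_distrib, Matrix.trace, Matrix.diag_apply, Matrix.mul_apply,
    Matrix.transpose_apply, Finset.sum_mul_sum]
  rw [add_comm]
  congr 1
  · rw [Finset.sum_comm]
  · simp only [mul_comm]

/-- Differentiating a trace opens the cycle at one letter, and contraction with `Q` glues the open
word, or its reversal, to `Q`. The result is a single trace, which is why traces have fluctuations
of order one. -/
lemma gradient_trace {V : ι → Matrix m m R} {D : m → m → Derivation ℝ R R} {r : ι → ℝ}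
    (hD : IsMatrixGradient V D r) (hV : ∀ i, (V i)ᵀ = V i) (Q w : List ι) :
    ∑ a, ∑ b, word V Q b a * D a b (word V w).trace = ((splits w).map fun x => r x.2.1 •
      ((word V (Q ++ (x.2.2 ++ x.1).reverse)).trace +
        (word V (Q ++ (x.2.2 ++ x.1))).trace)).sum := by
  have h : ∀ a b, D a b (word V w).trace = ((splits w).map fun x => r x.2.1 •
      (word V (x.2.2 ++ x.1) b a + word V (x.2.2 ++ x.1) a b)).sum := by
    intro a b
    simp only [Matrix.trace, Matrix.diag_apply, map_sum, gradient_word_apply hD, sum_list_sum]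
    congr 1
    refine List.map_congr_left fun x _ => ?_
    rw [← Finset.smul_sum, word_append, Matrix.mul_apply, Matrix.mul_apply,
      Finset.sum_add_distrib]
    simp only [mul_comm]
  simp only [h, ← List.sum_map_mul_left, sum_list_sum]
  congr 1
  refine List.map_congr_left fun x _ => ?_
  simp only [mul_smul_comm, ← Finset.smul_sum]
  congr 1
  rw [word_append V Q, word_append V Q, ← word_transpose V hV]
  generalize word V (x.2.2 ++ x.1) = BA
  simp only [mul_add, Finset.sum_add_distrib, Matrix.trace, Matrix.diag_apply, Matrix.mul_apply,
    Matrix.transpose_apply]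
  congr 1
  · rw [Finset.sum_comm]
  · rw [Finset.sum_comm]

end WordMatrices

/-! ### Integration by parts in the column and in the minor -/

section SchwingerDyson

open MvPolynomial

variable {ι : Type*} {n : ℕ}

/-- The covariance of the entries of a family of symmetric Gaussian matrices. -/
def goeCov (ρ : ι → ι → ℝ) (v u : ι × Sym2 (Fin (n + 1))) : ℝ :=
  if v.2 = u.2 then (if v.2.IsDiag then 2 else 1) * ρ v.1 u.1 else 0

/-- The normalized minor of the `i`-th matrix, as a matrix of polynomials in the entries. -/
noncomputable def minorVar (i : ι) :
    Matrix (Fin n) (Fin n) (MvPolynomial (ι × Sym2 (Fin (n + 1))) ℝ) :=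
  Matrix.of fun a b => (√(n : ℝ))⁻¹ • X (i, s(a.succ, b.succ))

/-- The normalized first column of the `i`-th matrix without its diagonal entry. -/
noncomputable def colVar (i : ι) : Fin n → MvPolynomial (ι × Sym2 (Fin (n + 1))) ℝ :=
  fun a => (√(n : ℝ))⁻¹ • X (i, s(0, a.succ))

/-- The quadratic form of a word of minors between two columns. -/
noncomputable def quadVar (i : ι) (w : List ι) (j : ι) :
    MvPolynomial (ι × Sym2 (Fin (n + 1))) ℝ :=
  colVar i ⬝ᵥ (word minorVar w *ᵥ colVar j)

lemma minorVar_transpose (i : ι) : (minorVar i : Matrix (Fin n) (Fin n) _)ᵀ = minorVar i := by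
  ext1 a b
  simp [minorVar, Sym2.eq_swap]

/-- The doubled variance on the diagonal makes the formula with `E_ab + E_ba` valid for `a = b` as
well. -/
lemma isMatrixGradient_minorVar (ρ : ι → ι → ℝ) (i : ι) :
    IsMatrixGradient (minorVar : ι → Matrix (Fin n) (Fin n) _)
      (fun a b => gaussDeriv (goeCov ρ) (i, s(a.succ, b.succ)))
      (fun j => (√(n : ℝ))⁻¹ * ρ i j) := by
  intro a b j
  ext1 c d
  simp only [minorVar, Matrix.map_apply, Matrix.of_apply, Derivation.map_smul, gaussDeriv_X,
    goeCov, Matrix.smul_apply, Matrix.add_apply, Matrix.single_apply, mul_smul]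
  congr 1
  rw [smul_eq_C_mul]
  by_cases h1 : a = c <;> by_cases h2 : b = d <;> by_cases h3 : a = d <;> by_cases h4 : b = c <;>
    simp_all
  rw [map_ofNat]
  ring

lemma gaussDeriv_col_minorVar (ρ : ι → ι → ℝ) (i : ι) (a : Fin n) (j : ι) :
    (minorVar j : Matrix (Fin n) (Fin n) _).map (gaussDeriv (goeCov ρ) (i, s(0, a.succ))) = 0 := by
  ext1 c d
  simp [minorVar, goeCov, (Fin.succ_ne_zero _).symm]

lemma gaussDeriv_col_word (ρ : ι → ι → ℝ) (i : ι) (a : Fin n) (w : List ι) :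
    (word minorVar w : Matrix (Fin n) (Fin n) _).map
      (gaussDeriv (goeCov ρ) (i, s(0, a.succ))) = 0 := by
  rw [map_derivation_word]
  simp only [gaussDeriv_col_minorVar, mul_zero, zero_mul]
  simp

lemma gaussDeriv_col_word_apply (ρ : ι → ι → ℝ) (i : ι) (a : Fin n) (w : List ι) (c d : Fin n) :
    gaussDeriv (goeCov ρ) (i, s(0, a.succ)) (word minorVar w c d) = 0 :=
  congrFun (congrFun (gaussDeriv_col_word ρ i a w) c) d

lemma gaussDeriv_col_colVar (ρ : ι → ι → ℝ) (i : ι) (a : Fin n) (j : ι) (b : Fin n) :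
    gaussDeriv (goeCov ρ) (i, s(0, a.succ)) (colVar j b) =
      if a = b then C ((√(n : ℝ))⁻¹ * ρ i j) else 0 := by
  by_cases h : a = b <;>
    simp [colVar, goeCov, (Fin.succ_ne_zero _).symm, h, smul_eq_C_mul]

lemma gaussDeriv_col_mulVec (ρ : ι → ι → ℝ) (i : ι) (a : Fin n) (w : List ι) (j : ι)
    (c : Fin n) :
    gaussDeriv (goeCov ρ) (i, s(0, a.succ)) ((word minorVar w *ᵥ colVar j) c) =
      ((√(n : ℝ))⁻¹ * ρ i j) • word minorVar w c a := by
  simp [Matrix.mulVec, dotProduct, Derivation.leibniz, gaussDeriv_col_word_apply,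
    gaussDeriv_col_colVar, smul_eq_C_mul, mul_comm]

lemma gaussDeriv_col_quadVar (ρ : ι → ι → ℝ) (i : ι) (a : Fin n) (i' : ι) (w : List ι) (j : ι) :
    gaussDeriv (goeCov ρ) (i, s(0, a.succ)) (quadVar i' w j) =
      ((√(n : ℝ))⁻¹ * ρ i i') • (word minorVar w *ᵥ colVar j) a +
      ((√(n : ℝ))⁻¹ * ρ i j) • (colVar i' ᵥ* word minorVar w) a := by
  rw [quadVar]
  simp only [dotProduct, map_sum, Derivation.leibniz, gaussDeriv_col_mulVec,
    gaussDeriv_col_colVar, Finset.sum_add_distrib, smul_eq_mul]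
  refine (add_comm _ _).trans ?_
  congr 1
  · simp [smul_eq_C_mul, mul_comm]
  · simp only [Matrix.vecMul, dotProduct, mul_smul_comm, Finset.smul_sum]

/-- The derivative removes one of the two columns of the second form, and the words are glued at the
gap. Removing the left column requires transposing `w`, hence the reversal. -/
lemma sum_mulVec_gaussDeriv_quadVar (ρ : ι → ι → ℝ) (hn : n ≠ 0) (i : ι) (w : List ι) (j : ι)
    (i' : ι) (w' : List ι) (j' : ι) :
    √(n : ℝ) • ∑ a, (word minorVar w *ᵥ colVar j) a *
        gaussDeriv (goeCov ρ) (i, s(0, a.succ)) (quadVar i' w' j') =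
      ρ i i' • quadVar (n := n) j (w.reverse ++ w') j' +
        ρ i j' • quadVar (n := n) i' (w' ++ w) j := by
  have hs : √(n : ℝ) ≠ 0 := by positivity
  simp only [gaussDeriv_col_quadVar, mul_add, Finset.sum_add_distrib, smul_add, mul_smul_comm,
    ← Finset.smul_sum, smul_smul]
  rw [mul_inv_cancel_left₀ hs, mul_inv_cancel_left₀ hs]
  congr 2
  · change (word minorVar w *ᵥ colVar j) ⬝ᵥ (word minorVar w' *ᵥ colVar j') = _
    rw [quadVar, word_append, ← Matrix.mulVec_mulVec, ← word_transpose _ minorVar_transpose,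
      Matrix.mulVec_transpose, dotProduct_comm (colVar j), ← Matrix.dotProduct_mulVec,
      dotProduct_comm]
  · change (word minorVar w *ᵥ colVar j) ⬝ᵥ (colVar i' ᵥ* word minorVar w') = _
    rw [quadVar, word_append, ← Matrix.mulVec_mulVec, Matrix.dotProduct_mulVec (colVar i'),
      dotProduct_comm]

variable {E : MvPolynomial (ι × Sym2 (Fin (n + 1))) ℝ →ₗ[ℝ] ℝ} {ρ : ι → ι → ℝ}

/-- Integration by parts in the left column `i`, which is uncorrelated with the minors: the
derivative hits either the right column, producing the trace of the word, or `G`. -/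
lemma expect_quadVar (hE : IsGaussianFunctional (goeCov ρ) E) (hn : n ≠ 0)
    (i : ι) (w : List ι) (j : ι) (G : MvPolynomial (ι × Sym2 (Fin (n + 1))) ℝ) :
    E (√(n : ℝ) • quadVar i w j * G) =
      E (((√(n : ℝ))⁻¹ * ρ i j) • (word minorVar w).trace * G +
        ∑ a, (word minorVar w *ᵥ colVar j) a * gaussDeriv (goeCov ρ) (i, s(0, a.succ)) G) := by
  have hs : √(n : ℝ) ≠ 0 := by positivity
  have e : √(n : ℝ) • quadVar i w j * G =
      ∑ a, X (i, s(0, a.succ)) * ((word minorVar w *ᵥ colVar j) a * G) := by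
    rw [quadVar, dotProduct, Finset.smul_sum, Finset.sum_mul]
    refine Finset.sum_congr rfl fun a _ => ?_
    rw [← smul_mul_assoc, colVar, smul_smul, mul_inv_cancel₀ hs, one_smul, mul_assoc]
  rw [e, map_sum]
  simp only [hE.ibp, Derivation.leibniz, gaussDeriv_col_mulVec, map_add, map_sum,
    Finset.sum_add_distrib, smul_eq_mul]
  rw [add_comm]
  congr 1
  rw [← map_sum]
  congr 1
  simp only [Matrix.trace, Matrix.diag_apply, Finset.smul_sum, mul_comm, Finset.mul_sum]

/-- Integration by parts in the first letter of the word; the first sum comes from the remaining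
letters `Q`, the second from `G`. -/
lemma expect_trace_word (hE : IsGaussianFunctional (goeCov ρ) E)
    (i : ι) (Q : List ι) (G : MvPolynomial (ι × Sym2 (Fin (n + 1))) ℝ) :
    E ((word minorVar (i :: Q)).trace * G) =
      E ((n : ℝ)⁻¹ • ((splits Q).map fun x => ρ i x.2.1 •
          ((word minorVar x.1).trace * (word minorVar x.2.2).trace +
            (word minorVar (x.1 ++ x.2.2.reverse)).trace)).sum * G +
        (√(n : ℝ))⁻¹ • ∑ a : Fin n, ∑ b : Fin n, word minorVar Q b a *
          gaussDeriv (goeCov ρ) (i, s(a.succ, b.succ)) G) := by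
  have e : (word minorVar (i :: Q)).trace * G = (√(n : ℝ))⁻¹ • ∑ a : Fin n, ∑ b : Fin n,
      X (i, s(a.succ, b.succ)) * (word minorVar Q b a * G) := by
    simp only [word_cons, Matrix.trace, Matrix.diag_apply, Matrix.mul_apply, Finset.sum_mul,
      Finset.smul_sum, minorVar, Matrix.of_apply, smul_mul_assoc, mul_assoc]
  have hs : (n : ℝ)⁻¹ = (√(n : ℝ))⁻¹ * (√(n : ℝ))⁻¹ := by
    rw [← mul_inv, Real.mul_self_sqrt (by positivity)]
  have h : (n : ℝ)⁻¹ • ((splits Q).map fun x => ρ i x.2.1 •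
          ((word minorVar x.1).trace * (word minorVar x.2.2).trace +
            (word minorVar (x.1 ++ x.2.2.reverse)).trace)).sum =
      (√(n : ℝ))⁻¹ • ∑ a : Fin n, ∑ b : Fin n,
        gaussDeriv (goeCov ρ) (i, s(a.succ, b.succ)) (word minorVar Q b a) := by
    rw [sum_gradient_word (isMatrixGradient_minorVar (n := n) ρ i) minorVar_transpose Q, hs,
      mul_smul, List.smul_sum, List.map_map]
    simp only [Function.comp_def, mul_smul]
  rw [e, h, smul_mul_assoc, ← smul_add, map_smul, map_smul]
  simp only [map_sum, hE.ibp, Derivation.leibniz, map_add, smul_eq_mul, Finset.sum_add_distrib,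
    Finset.sum_mul, mul_comm G]
  rw [add_comm]

end SchwingerDyson

/-! ### The closed system of equations for centered observables -/

section CenteredObservables

open MvPolynomial

lemma derivation_sum_apply {A β : Type*} [CommRing A] [Algebra ℝ A] (s : Finset β)
    (D : β → Derivation ℝ A A) (G : A) : (∑ b ∈ s, D b) G = ∑ b ∈ s, D b G := by
  induction s using Finset.cons_induction with
  | empty => simp
  | cons b s hb ih => rw [Finset.sum_cons, Finset.sum_cons, Derivation.add_apply, ih]

variable {ι : Type*} {n : ℕ}

/-- The polynomial in the centered traces that represents the normalized trace of a word. -/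
noncomputable def trPoly (ρ : ι → ι → ℝ) (s : ℝ) (w : List ι) : MvPolynomial (List ι) ℝ :=
  (s * s) • X w + C (tau ρ w)

/-- The part of the Schwinger--Dyson equation for `tr (i :: Q)` that comes from its own letters. -/
noncomputable def trMain (ρ : ι → ι → ℝ) (s : ℝ) (i : ι) (Q : List ι) :
    MvPolynomial (List ι) ℝ :=
  ((splits Q).map fun x => ρ i x.2.1 • ((s * s) • (X x.1 * X x.2.2) + tau ρ x.1 • X x.2.2 +
    tau ρ x.2.2 • X x.1 + trPoly ρ s (x.1 ++ x.2.2.reverse))).sum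

/-- The part of the Schwinger--Dyson equation for `tr (i :: Q)` that comes from other factors. -/
noncomputable def trDeriv (ρ : ι → ι → ℝ) (s : ℝ) (i : ι) (Q : List ι) :
    Derivation ℝ (MvPolynomial (List ι) ℝ) (MvPolynomial (List ι) ℝ) :=
  mkDerivation ℝ fun u => ((splits u).map fun x => ρ i x.2.1 •
    (trPoly ρ s (Q ++ (x.2.2 ++ x.1).reverse) + trPoly ρ s (Q ++ (x.2.2 ++ x.1)))).sum

/-- The centered trace of a word in the minors. -/
noncomputable def trVal (ρ : ι → ι → ℝ) (w : List ι) :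
    MvPolynomial (ι × Sym2 (Fin (n + 1))) ℝ :=
  (word minorVar w).trace - C (n * tau ρ w)

lemma inv_sqrt_mul_self (n : ℕ) : (√(n : ℝ))⁻¹ * (√(n : ℝ))⁻¹ = (n : ℝ)⁻¹ := by
  rw [← mul_inv, Real.mul_self_sqrt (by positivity)]

lemma trVal_nil (ρ : ι → ι → ℝ) : trVal (n := n) ρ [] = 0 := by
  simp [trVal]

lemma aeval_trPoly (ρ : ι → ι → ℝ) (hn : n ≠ 0) (w : List ι) :
    aeval (trVal (n := n) ρ) (trPoly ρ (√(n : ℝ))⁻¹ w) =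
      (n : ℝ)⁻¹ • (word minorVar w).trace := by
  have : (n : ℝ) ≠ 0 := by positivity
  rw [trPoly, inv_sqrt_mul_self]
  simp only [map_add, map_smul, aeval_X, aeval_C, trVal, smul_sub, algebraMap_eq]
  rw [smul_eq_C_mul (C _), ← C_mul, inv_mul_cancel_left₀ this, sub_add_cancel]

lemma map_list_sum_map {α A B F : Type*} [AddCommMonoid A] [AddCommMonoid B] [FunLike F A B]
    [AddMonoidHomClass F A B] (φ : F) (l : List α) (f : α → A) :
    φ (l.map f).sum = (l.map fun x => φ (f x)).sum := by
  rw [map_list_sum, List.map_map]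
  rfl

/-- Substitute `Tr = trVal + n τ` in the product of two traces. The terms of order `n` add up to `n
τ(i :: Q)` by the recursion `tau_cons`, so the centering removes them. -/
lemma aeval_trMain (ρ : ι → ι → ℝ) (hn : n ≠ 0) (i : ι) (Q : List ι) :
    aeval (trVal (n := n) ρ) (trMain ρ (√(n : ℝ))⁻¹ i Q) =
      (n : ℝ)⁻¹ • ((splits Q).map fun x => ρ i x.2.1 •
          ((word minorVar x.1).trace * (word minorVar x.2.2).trace +
            (word minorVar (x.1 ++ x.2.2.reverse)).trace)).sum - C (n * tau ρ (i :: Q)) := by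
  have hn' : (n : ℝ) ≠ 0 := by positivity
  have hc : (C (n * tau ρ (i :: Q)) : MvPolynomial (ι × Sym2 (Fin (n + 1))) ℝ) =
      ((splits Q).map fun x => C (n * (ρ i x.2.1 * (tau ρ x.1 * tau ρ x.2.2)))).sum := by
    rw [tau_cons, ← List.sum_map_mul_left, map_list_sum_map]
  rw [trMain, map_list_sum_map, hc, List.smul_sum, List.map_map, eq_sub_iff_add_eq,
    ← List.sum_map_add]
  congr 1
  refine List.map_congr_left fun x _ => ?_
  simp only [map_add, map_smul, aeval_trPoly ρ hn, inv_sqrt_mul_self, map_mul, aeval_X, trVal,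
    Function.comp_apply, map_natCast]
  simp only [smul_eq_C_mul]
  have h1 : (C ((n : ℝ)⁻¹) : MvPolynomial (ι × Sym2 (Fin (n + 1))) ℝ) * (n : MvPolynomial _ ℝ) =
      1 := by
    rw [← map_natCast (C : ℝ →+* MvPolynomial (ι × Sym2 (Fin (n + 1))) ℝ), ← C_mul,
      inv_mul_cancel₀ hn', C_1]
  generalize (C ((n : ℝ)⁻¹) : MvPolynomial (ι × Sym2 (Fin (n + 1))) ℝ) = k at h1 ⊢
  linear_combination C (ρ i x.2.1) * (C (tau ρ x.1) * C (tau ρ x.2.2) * n -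
    C (tau ρ x.2.2) * (word minorVar x.1).trace -
    C (tau ρ x.1) * (word minorVar x.2.2).trace) * h1

variable {E : MvPolynomial (ι × Sym2 (Fin (n + 1))) ℝ →ₗ[ℝ] ℝ} {ρ : ι → ι → ℝ}

/-- The Schwinger--Dyson equation for centered traces. -/
lemma schwingerDyson_tr (hE : IsGaussianFunctional (goeCov ρ) E) (hn : n ≠ 0) (i : ι)
    (Q : List ι) (p : MvPolynomial (List ι) ℝ) :
    E (aeval (trVal ρ) (X (i :: Q) * p)) =
      E (aeval (trVal ρ) (trMain ρ (√(n : ℝ))⁻¹ i Q * p + trDeriv ρ (√(n : ℝ))⁻¹ i Q p)) := by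
  let D' : Derivation ℝ (MvPolynomial (ι × Sym2 (Fin (n + 1))) ℝ)
      (MvPolynomial (ι × Sym2 (Fin (n + 1))) ℝ) :=
    (√(n : ℝ))⁻¹ • ∑ a : Fin n, ∑ b : Fin n, word minorVar Q b a •
      gaussDeriv (goeCov ρ) (i, s(a.succ, b.succ))
  have hD'_apply : ∀ G, D' G = (√(n : ℝ))⁻¹ • ∑ a : Fin n, ∑ b : Fin n,
      word minorVar Q b a * gaussDeriv (goeCov ρ) (i, s(a.succ, b.succ)) G := by
    intro G
    simp only [D', Derivation.smul_apply, derivation_sum_apply, smul_eq_mul]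
  have hD' := derivation_aeval (trVal ρ) (trDeriv ρ (√(n : ℝ))⁻¹ i Q) D' (fun u => by
    rw [trDeriv, mkDerivation_X, map_list_sum_map, hD'_apply]
    simp only [trVal, map_sub, ← algebraMap_eq, Derivation.map_algebraMap, sub_zero]
    rw [gradient_trace (isMatrixGradient_minorVar (n := n) ρ i) minorVar_transpose,
      List.smul_sum, List.map_map]
    congr 1
    refine List.map_congr_left fun x _ => ?_
    simp only [Function.comp_apply, map_smul, map_add, aeval_trPoly ρ hn]
    rw [← smul_add, smul_smul, smul_smul, ← inv_sqrt_mul_self]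
    congr 1
    ring) p
  rw [map_add (aeval _), map_mul (aeval _), map_mul (aeval _), aeval_X, aeval_trMain ρ hn, ← hD', trVal, sub_mul, sub_mul,
    map_sub, expect_trace_word hE, hD'_apply, ← map_sub]
  congr 1
  ring

/-- Centered and normalized quadratic forms and traces, and the corner entries. -/
inductive Atom (ι : Type*) where
  | quad (i : ι) (w : List ι) (j : ι)
  | tr (w : List ι)
  | diag (i : ι)

/-- The random variable of an atom. -/
noncomputable def atomVal (ρ : ι → ι → ℝ) : Atom ι → MvPolynomial (ι × Sym2 (Fin (n + 1))) ℝ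
  | .quad i w j => √(n : ℝ) • quadVar i w j - C (√(n : ℝ) * (ρ i j * tau ρ w))
  | .tr w => trVal ρ w
  | .diag i => X (i, s(0, 0))

/-- The polynomial in the atoms that represents a quadratic form. -/
noncomputable def quadPoly (ρ : ι → ι → ℝ) (s : ℝ) (i : ι) (w : List ι) (j : ι) :
    MvPolynomial (Atom ι) ℝ :=
  s • X (.quad i w j) + C (ρ i j * tau ρ w)

/-- The derivation of the Schwinger--Dyson equation for a quadratic form. -/
noncomputable def quadDeriv (ρ : ι → ι → ℝ) (s : ℝ) (i : ι) (w : List ι) (j : ι) :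
    Derivation ℝ (MvPolynomial (Atom ι) ℝ) (MvPolynomial (Atom ι) ℝ) :=
  mkDerivation ℝ fun b => match b with
    | .quad i' w' j' => ρ i i' • quadPoly ρ s j (w.reverse ++ w') j' +
        ρ i j' • quadPoly ρ s i' (w' ++ w) j
    | .tr _ => 0
    | .diag _ => 0

/-- The derivation of the integration by parts for a corner entry. -/
noncomputable def diagDeriv (ρ : ι → ι → ℝ) (i : ι) :
    Derivation ℝ (MvPolynomial (Atom ι) ℝ) (MvPolynomial (Atom ι) ℝ) :=
  mkDerivation ℝ fun b => match b with
    | .quad _ _ _ => 0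
    | .tr _ => 0
    | .diag j => C (2 * ρ i j)

lemma aeval_quadPoly (ρ : ι → ι → ℝ) (hn : n ≠ 0) (i : ι) (w : List ι) (j : ι) :
    aeval (atomVal (n := n) ρ) (quadPoly ρ (√(n : ℝ))⁻¹ i w j) = quadVar i w j := by
  have : √(n : ℝ) ≠ 0 := by positivity
  rw [quadPoly]
  simp only [map_add, map_smul, aeval_X, aeval_C, atomVal, smul_sub, algebraMap_eq]
  rw [smul_eq_C_mul (C _), ← C_mul, inv_mul_cancel_left₀ this, sub_add_cancel, smul_smul,
    inv_mul_cancel₀ this, one_smul]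

/-- The Schwinger--Dyson equation for centered quadratic forms. -/
lemma schwingerDyson_quad (hE : IsGaussianFunctional (goeCov ρ) E) (hn : n ≠ 0) (i : ι)
    (w : List ι) (j : ι) (p : MvPolynomial (Atom ι) ℝ) :
    E (aeval (atomVal ρ) (X (.quad i w j) * p)) =
      E (aeval (atomVal ρ) (((√(n : ℝ))⁻¹ * ρ i j) • (X (.tr w) * p) +
        quadDeriv ρ (√(n : ℝ))⁻¹ i w j p)) := by
  have hs : √(n : ℝ) ≠ 0 := by positivity
  let D' : Derivation ℝ (MvPolynomial (ι × Sym2 (Fin (n + 1))) ℝ)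
      (MvPolynomial (ι × Sym2 (Fin (n + 1))) ℝ) :=
    ∑ a : Fin n, (word minorVar w *ᵥ colVar j) a • gaussDeriv (goeCov ρ) (i, s(0, a.succ))
  have hD'_apply : ∀ G, D' G = ∑ a : Fin n, (word minorVar w *ᵥ colVar j) a *
      gaussDeriv (goeCov ρ) (i, s(0, a.succ)) G := by
    intro G
    simp only [D', Derivation.smul_apply, derivation_sum_apply, smul_eq_mul]
  have hD' := derivation_aeval (atomVal ρ) (quadDeriv ρ (√(n : ℝ))⁻¹ i w j) D' (fun b => by
    rw [quadDeriv, mkDerivation_X]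
    match b with
    | .quad i' w' j' =>
      simp only [map_add, map_smul, aeval_quadPoly ρ hn, atomVal, map_sub, ← algebraMap_eq,
        Derivation.map_algebraMap, sub_zero]
      rw [hD'_apply, ← sum_mulVec_gaussDeriv_quadVar ρ hn]
      simp only [Derivation.map_smul, mul_smul_comm, Finset.smul_sum]
    | .tr u =>
      rw [hD'_apply]
      simp only [atomVal, trVal, map_sub, Matrix.trace, Matrix.diag_apply, map_sum,
        gaussDeriv_col_word_apply, ← algebraMap_eq, Derivation.map_algebraMap]
      simp
    | .diag k =>
      rw [hD'_apply]
      simp [atomVal, goeCov, Fin.succ_ne_zero]) p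
  rw [map_mul (aeval _), aeval_X, map_add (aeval _), map_smul (aeval _), map_mul (aeval _),
    aeval_X, ← hD', hD'_apply]
  simp only [atomVal]
  rw [sub_mul, map_sub, expect_quadVar hE hn, ← map_sub]
  congr 1
  -- The centering of the form equals `n^{-1/2} ρ i j` times the centering `n τ(w)` of the trace, so
  -- exactly the centered trace remains.
  have hc : √(n : ℝ) * (ρ i j * tau ρ w) = (√(n : ℝ))⁻¹ * ρ i j * (n * tau ρ w) := by
    have : √(n : ℝ) = (√(n : ℝ))⁻¹ * n := by
      field_simp
      exact Real.sq_sqrt (by positivity)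
    nth_rewrite 1 [this]
    ring
  rw [hc, C_mul (a := (√(n : ℝ))⁻¹ * ρ i j), trVal]
  simp only [smul_eq_C_mul]
  ring

lemma schwingerDyson_diag (hE : IsGaussianFunctional (goeCov ρ) E) (i : ι)
    (p : MvPolynomial (Atom ι) ℝ) :
    E (aeval (atomVal ρ) (X (.diag i) * p)) = E (aeval (atomVal ρ) (diagDeriv ρ i p)) := by
  -- The corner entry is uncorrelated with the minors and the columns, so its derivation only sees
  -- corner atoms.
  have hW : ∀ (k : ι), (minorVar k : Matrix (Fin n) (Fin n) _).map
      (gaussDeriv (goeCov ρ) (i, s(0, 0))) = 0 := by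
    intro k
    ext1 c d
    simp [minorVar, goeCov, (Fin.succ_ne_zero _).symm]
  have hw : ∀ (w : List ι) (c d : Fin n),
      gaussDeriv (goeCov ρ) (i, s(0, 0)) (word minorVar w c d) = 0 := by
    intro w c d
    have h : (word minorVar w).map (gaussDeriv (goeCov ρ) (i, s((0 : Fin (n + 1)), 0))) = 0 := by
      rw [map_derivation_word]
      simp only [hW, mul_zero, zero_mul]
      simp
    exact congrFun (congrFun h c) d
  have hcol : ∀ (k : ι) (c : Fin n), gaussDeriv (goeCov ρ) (i, s(0, 0)) (colVar k c) = 0 := by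
    intro k c
    simp [colVar, goeCov, (Fin.succ_ne_zero _).symm]
  rw [map_mul (aeval _), aeval_X]
  simp only [atomVal]
  rw [hE.ibp, derivation_aeval (atomVal ρ) (diagDeriv ρ i)]
  intro b
  rw [diagDeriv, mkDerivation_X]
  match b with
  | .quad i' w' j' =>
    simp [atomVal, quadVar, dotProduct, Matrix.mulVec, Derivation.leibniz, hw, hcol]
  | .tr u =>
    simp [atomVal, trVal, Matrix.trace, hw]
  | .diag k => simp [atomVal, goeCov]

end CenteredObservables

/-! ### Uniform bounds and asymptotic integration by parts -/

section Tightness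

open MvPolynomial

/-- The functionals `F x` are bounded, uniformly in `x`, on the elements `f x`. -/
def Tight {Θ A : Type*} [AddCommGroup A] [Module ℝ A] (F : Θ → A →ₗ[ℝ] ℝ) (f : Θ → A) : Prop :=
  ∃ C, ∀ x, |F x (f x)| ≤ C

section

variable {Θ A : Type*} [AddCommGroup A] [Module ℝ A] {F : Θ → A →ₗ[ℝ] ℝ}

lemma Tight.add {f g : Θ → A} (hf : Tight F f) (hg : Tight F g) :
    Tight F fun x => f x + g x := by
  obtain ⟨C, hC⟩ := hf
  obtain ⟨C', hC'⟩ := hg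
  refine ⟨C + C', fun x => ?_⟩
  rw [map_add]
  exact (abs_add_le _ _).trans (add_le_add (hC x) (hC' x))

lemma Tight.smul {f : Θ → A} (hf : Tight F f) {c : Θ → ℝ} (hc : ∃ C, ∀ x, |c x| ≤ C) :
    Tight F fun x => c x • f x := by
  obtain ⟨C, hC⟩ := bounded_mul hc hf
  exact ⟨C, fun x => by simpa using hC x⟩

lemma tight_zero : Tight F fun _ => 0 := ⟨0, fun x => by simp⟩

lemma tight_list_sum {α : Type*} (l : List α) (f : Θ → α → A)
    (h : ∀ a ∈ l, Tight F fun x => f x a) : Tight F fun x => (l.map (f x)).sum := by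
  induction l with
  | nil => simpa using tight_zero
  | cons a l ih =>
    simp only [List.map_cons, List.sum_cons]
    exact (h a (by simp)).add (ih fun b hb => h b (by simp [hb]))

lemma Tight.congr {f g : Θ → A} (hf : Tight F f) (h : ∀ x, f x = g x) : Tight F g := by
  rwa [show g = f from funext fun x => (h x).symm]

end

/-- The product of the variables in a list. -/
noncomputable def lprod {σ : Type*} (l : List σ) : MvPolynomial σ ℝ := (l.map X).prod

@[simp]
lemma lprod_nil {σ : Type*} : (lprod [] : MvPolynomial σ ℝ) = 1 := rfl

lemma lprod_cons {σ : Type*} (a : σ) (l : List σ) : lprod (a :: l) = X a * lprod l := by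
  simp [lprod]

lemma lprod_append {σ : Type*} (l l' : List σ) : lprod (l ++ l') = lprod l * lprod l' := by
  simp [lprod]

lemma lprod_perm {σ : Type*} {l l' : List σ} (h : l.Perm l') : lprod l = lprod l' :=
  (h.map X).prod_eq

lemma lprod_induction {σ : Type*} {P : MvPolynomial σ ℝ → Prop} (hl : ∀ l, P (lprod l))
    (hadd : ∀ p q, P p → P q → P (p + q)) (hsmul : ∀ (r : ℝ) p, P p → P (r • p))
    (p : MvPolynomial σ ℝ) : P p := by
  suffices h : ∀ l, P (lprod l * p) by simpa using h []
  induction p using MvPolynomial.induction_on with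
  | C a =>
    intro l
    rw [mul_comm, ← smul_eq_C_mul]
    exact hsmul a _ (hl l)
  | add p q hp hq => intro l; rw [mul_add]; exact hadd _ _ (hp l) (hq l)
  | mul_X p i hp =>
    intro l
    have := hp (i :: l)
    rwa [lprod_cons, mul_comm (X i), mul_assoc, mul_comm (X i)] at this

/-- By Leibniz it suffices to bound the terms in which one factor is differentiated; `l₁` collects
the factors already passed. The weight bound `N` makes this usable inside an induction on the
weight. -/
lemma tight_lprod_mul_derivation {Θ σ : Type*} {F : Θ → MvPolynomial σ ℝ →ₗ[ℝ] ℝ}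
    (D : Θ → Derivation ℝ (MvPolynomial σ ℝ) (MvPolynomial σ ℝ)) (wt : σ → ℕ) (N : ℕ)
    (h : ∀ b l, wt b + (l.map wt).sum ≤ N → Tight F fun x => D x (X b) * lprod l)
    (l₂ l₁ : List σ) (hl : (l₁.map wt).sum + (l₂.map wt).sum ≤ N) :
    Tight F fun x => lprod l₁ * D x (lprod l₂) := by
  induction l₂ generalizing l₁ with
  | nil => simpa using tight_zero
  | cons b l ih =>
    simp only [List.map_cons, List.sum_cons] at hl
    have h1 := ih (b :: l₁) (by simp only [List.map_cons, List.sum_cons]; omega)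
    have h2 := h b (l₁ ++ l) (by simp only [List.map_append, List.sum_append]; omega)
    refine (h1.add h2).congr fun x => ?_
    simp only [lprod_cons, lprod_append, Derivation.leibniz, smul_eq_mul]
    ring

variable {Θ ι : Type*} {n : Θ → ℕ} {ρ : Θ → ι → ι → ℝ}
  {E : ∀ x, MvPolynomial (ι × Sym2 (Fin (n x + 1))) ℝ →ₗ[ℝ] ℝ}

/-- The expectation of polynomials in the centered traces. -/
noncomputable def trExp (ρ : Θ → ι → ι → ℝ)
    (E : ∀ x, MvPolynomial (ι × Sym2 (Fin (n x + 1))) ℝ →ₗ[ℝ] ℝ) (x : Θ) :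
    MvPolynomial (List ι) ℝ →ₗ[ℝ] ℝ :=
  E x ∘ₗ (aeval (trVal (ρ x))).toLinearMap

/-- The expectation of polynomials in the atoms. -/
noncomputable def atomExp (ρ : Θ → ι → ι → ℝ)
    (E : ∀ x, MvPolynomial (ι × Sym2 (Fin (n x + 1))) ℝ →ₗ[ℝ] ℝ) (x : Θ) :
    MvPolynomial (Atom ι) ℝ →ₗ[ℝ] ℝ :=
  E x ∘ₗ (aeval (atomVal (ρ x))).toLinearMap

lemma inv_sqrt_bounded (n : Θ → ℕ) : ∃ C : ℝ, ∀ x, |(√(n x : ℝ))⁻¹| ≤ C := by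
  refine ⟨1, fun x => ?_⟩
  rw [abs_of_nonneg (by positivity)]
  rcases Nat.eq_zero_or_pos (n x) with h | h
  · simp [h]
  · refine inv_le_one_of_one_le₀ ?_
    rw [Real.one_le_sqrt]
    exact_mod_cast h

lemma tight_trPoly_mul {F : Θ → MvPolynomial (List ι) ℝ →ₗ[ℝ] ℝ}
    (hρ : ∀ i j, ∃ C, ∀ x, |ρ x i j| ≤ C) {s : Θ → ℝ} (hs : ∃ C, ∀ x, |s x| ≤ C)
    (w : List ι) (l : List (List ι)) (h1 : Tight F fun _ => lprod (w :: l))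
    (h2 : Tight F fun _ => lprod l) : Tight F fun x => trPoly (ρ x) (s x) w * lprod l := by
  refine ((h1.smul (bounded_mul hs hs)).add (h2.smul (tau_bounded ρ hρ w))).congr fun x => ?_
  rw [trPoly, lprod_cons]
  simp only [smul_eq_C_mul]
  ring

/-- Mixed moments of centered traces are bounded. -/
theorem tight_tr (hn : ∀ x, n x ≠ 0) (hρ : ∀ i j, ∃ C, ∀ x, |ρ x i j| ≤ C)
    (hE : ∀ x, IsGaussianFunctional (goeCov (ρ x)) (E x)) (l : List (List ι)) :
    Tight (trExp ρ E) fun _ => lprod l := by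
  induction hN : (l.map fun w => w.length + 1).sum using Nat.strong_induction_on generalizing l with
  | _ N ih =>
    have hs := inv_sqrt_bounded n
    match l with
    | [] => exact ⟨1, fun x => by simp [trExp, (hE x).map_one]⟩
    -- The trace of the empty word is the constant `n`, so its centered version is zero.
    | [] :: l => exact ⟨0, fun x => by simp [trExp, lprod_cons, trVal_nil]⟩
    | (i :: Q) :: l =>
      simp only [List.map_cons, List.sum_cons, List.length_cons] at hN
      have hSD : ∀ x, trExp ρ E x (lprod ((i :: Q) :: l)) =
          trExp ρ E x (trMain (ρ x) (√(n x : ℝ))⁻¹ i Q * lprod l +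
            trDeriv (ρ x) (√(n x : ℝ))⁻¹ i Q (lprod l)) := fun x => by
        rw [lprod_cons]
        exact schwingerDyson_tr (hE x) (hn x) i Q (lprod l)
      suffices h : Tight (trExp ρ E) fun x => trMain (ρ x) (√(n x : ℝ))⁻¹ i Q * lprod l +
            trDeriv (ρ x) (√(n x : ℝ))⁻¹ i Q (lprod l) by
        obtain ⟨C, hC⟩ := h
        exact ⟨C, fun x => by rw [hSD]; exact hC x⟩
      refine Tight.add ?_ ?_
      · simp only [trMain, ← List.sum_map_mul_right]
        refine tight_list_sum _ (fun x (y : List ι × ι × List ι) => (ρ x i y.2.1 •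
          (((√(n x : ℝ))⁻¹ * (√(n x : ℝ))⁻¹) • (X y.1 * X y.2.2) + tau (ρ x) y.1 • X y.2.2 +
          tau (ρ x) y.2.2 • X y.1 + trPoly (ρ x) (√(n x : ℝ))⁻¹ (y.1 ++ y.2.2.reverse))) *
            lprod l) fun y hy => ?_
        have hlen := length_of_mem_splits hy
        -- Losing the letter `i` and its partner, the word of weight `|Q| + 2` becomes two words of
        -- total weight `|Q| + 1`; all other terms are lighter still.
        have h1 := ih _ (by simp only [List.map_cons, List.sum_cons]; omega)
          (y.1 :: y.2.2 :: l) rfl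
        have h2 := ih _ (by simp only [List.map_cons, List.sum_cons]; omega) (y.2.2 :: l) rfl
        have h3 := ih _ (by simp only [List.map_cons, List.sum_cons]; omega) (y.1 :: l) rfl
        have h4 := ih _ (by simp only [List.map_cons, List.sum_cons, List.length_append,
          List.length_reverse]; omega) ((y.1 ++ y.2.2.reverse) :: l) rfl
        have h5 := ih _ (by omega) l rfl
        refine (((((h1.smul (bounded_mul hs hs)).add (h2.smul (tau_bounded ρ hρ y.1))).add
          (h3.smul (tau_bounded ρ hρ y.2.2))).add
          (tight_trPoly_mul hρ hs _ l h4 h5)).smul (hρ i y.2.1)).congr fun x => ?_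
        simp only [lprod_cons, smul_eq_C_mul]
        ring
      · have := tight_lprod_mul_derivation (F := trExp ρ E)
          (fun x => trDeriv (ρ x) (√(n x : ℝ))⁻¹ i Q) (fun w => w.length + 1)
          ((l.map fun w => w.length + 1).sum) (fun u l' hl' => ?_) l [] (by simp)
        · simpa using this
        simp only [trDeriv, mkDerivation_X, ← List.sum_map_mul_right]
        refine tight_list_sum _ (fun x (y : List ι × ι × List ι) => (ρ x i y.2.1 •
          (trPoly (ρ x) (√(n x : ℝ))⁻¹ (Q ++ (y.2.2 ++ y.1).reverse) +
            trPoly (ρ x) (√(n x : ℝ))⁻¹ (Q ++ (y.2.2 ++ y.1)))) * lprod l') fun y hy => ?_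
        have hlen := length_of_mem_splits hy
        -- The words `i :: Q` and `u` lose one letter each and merge, so the total weight drops by
        -- three.
        have h1 := ih _ (by simp only [List.map_cons, List.sum_cons, List.length_append,
          List.length_reverse]; omega) ((Q ++ (y.2.2 ++ y.1).reverse) :: l') rfl
        have h2 := ih _ (by simp only [List.map_cons, List.sum_cons, List.length_append];
                            omega) ((Q ++ (y.2.2 ++ y.1)) :: l') rfl
        have h3 := ih _ (by omega) l' rfl
        refine (((tight_trPoly_mul hρ hs _ l' h1 h3).add
          (tight_trPoly_mul hρ hs _ l' h2 h3)).smul (hρ i y.2.1)).congr fun x => ?_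
        simp only [smul_eq_C_mul]
        ring

/-- The number of random variables in an atom, up to a shift. -/
def atomWeight : Atom ι → ℕ
  | .quad _ w _ => w.length + 2
  | .tr w => w.length + 1
  | .diag _ => 1

lemma tight_quadPoly_mul {F : Θ → MvPolynomial (Atom ι) ℝ →ₗ[ℝ] ℝ}
    (hρ : ∀ i j, ∃ C, ∀ x, |ρ x i j| ≤ C) {s : Θ → ℝ} (hs : ∃ C, ∀ x, |s x| ≤ C)
    (i : ι) (w : List ι) (j : ι) (l : List (Atom ι))
    (h1 : Tight F fun _ => lprod (.quad i w j :: l))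
    (h2 : Tight F fun _ => lprod l) : Tight F fun x => quadPoly (ρ x) (s x) i w j * lprod l := by
  refine ((h1.smul hs).add (h2.smul (bounded_mul (hρ i j) (tau_bounded ρ hρ w)))).congr
    fun x => ?_
  rw [quadPoly, lprod_cons]
  simp only [smul_eq_C_mul]
  ring

/-- Mixed moments of atoms are bounded. -/
theorem tight_lprod_atom (hn : ∀ x, n x ≠ 0) (hρ : ∀ i j, ∃ C, ∀ x, |ρ x i j| ≤ C)
    (hE : ∀ x, IsGaussianFunctional (goeCov (ρ x)) (E x)) (l : List (Atom ι)) :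
    Tight (atomExp ρ E) fun _ => lprod l := by
  induction hN : (l.map atomWeight).sum using Nat.strong_induction_on generalizing l with
  | _ N ih =>
    have hs := inv_sqrt_bounded n
    have hhead : ∀ (a : Atom ι) (l' : List (Atom ι)) (f : Θ → MvPolynomial (Atom ι) ℝ),
        l.Perm (a :: l') → (∀ x, atomExp ρ E x (X a * lprod l') = atomExp ρ E x (f x)) →
        Tight (atomExp ρ E) f → Tight (atomExp ρ E) fun _ => lprod l := by
      rintro a l' f hl hf ⟨C, hC⟩
      exact ⟨C, fun x => by rw [lprod_perm hl, lprod_cons, hf]; exact hC x⟩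
    -- If some factor is not a trace, it is moved to the front and integrated by parts; products of
    -- traces alone are covered by `tight_tr`.
    by_cases h : ∀ a ∈ l, a ∈ Set.range (Atom.tr : List ι → Atom ι)
    · have : l ∈ Set.range (List.map (Atom.tr : List ι → Atom ι)) := by
        rw [Set.range_list_map]; exact h
      obtain ⟨l₀, rfl⟩ := this
      obtain ⟨C, hC⟩ := tight_tr hn hρ hE l₀
      refine ⟨C, fun x => ?_⟩
      have e : atomExp ρ E x (lprod (l₀.map Atom.tr)) = trExp ρ E x (lprod l₀) := by
        simp only [atomExp, trExp, LinearMap.comp_apply, AlgHom.toLinearMap_apply, lprod,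
          map_list_prod, List.map_map, Function.comp_def, aeval_X, atomVal]
      rw [e]
      exact hC x
    push Not at h
    obtain ⟨a, ha, hna⟩ := h
    obtain ⟨l₁, l₂, rfl⟩ := List.append_of_mem ha
    set l' := l₁ ++ l₂
    have hperm : (l₁ ++ a :: l₂).Perm (a :: l') := List.perm_middle
    have hN' : atomWeight a + (l'.map atomWeight).sum = N := by
      rw [← hN, (hperm.map atomWeight).sum_eq]
      simp
    have ih0 := fun (l : List (Atom ι)) (hl : (l.map atomWeight).sum < N) => ih _ hl l rfl
    match a with
    | .tr w => exact absurd ⟨w, rfl⟩ hna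
    | .diag i =>
      refine hhead _ l' _ hperm (fun x => schwingerDyson_diag (hE x) i (lprod l')) ?_
      have := tight_lprod_mul_derivation (F := atomExp ρ E)
          (fun x => diagDeriv (ρ x) i) atomWeight
          ((l'.map atomWeight).sum) (fun b l'' hl => ?_) l' [] (by simp)
      · simpa using this
      simp only [diagDeriv, mkDerivation_X]
      simp only [atomWeight] at hN'
      match b with
      | .quad _ _ _ => simpa using tight_zero
      | .tr _ => simpa using tight_zero
      | .diag j =>
        refine ((ih0 l'' (by omega)).smul (bounded_mul ⟨2, fun _ => ?_⟩ (hρ i j))).congr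
          fun x => smul_eq_C_mul _ _
        norm_num
    | .quad i w j =>
      refine hhead _ l' _ hperm
        (fun x => schwingerDyson_quad (hE x) (hn x) i w j (lprod l')) ?_
      simp only [atomWeight] at hN'
      refine Tight.add ?_ ?_
      -- The equation replaces `quad i w j` by `tr w`. The weights `|w| + 2` and `|w| + 1` are
      -- chosen so that this counts as a decrease.
      · refine Tight.smul ?_ (bounded_mul hs (hρ i j))
        simp only [← lprod_cons]
        refine ih0 _ ?_
        simp only [List.map_cons, List.sum_cons, atomWeight]
        omega
      · have := tight_lprod_mul_derivation (F := atomExp ρ E)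
          (fun x => quadDeriv (ρ x) (√(n x : ℝ))⁻¹ i w j) atomWeight
          ((l'.map atomWeight).sum) (fun b l'' hl => ?_) l' [] (by simp)
        · simpa using this
        simp only [quadDeriv, mkDerivation_X]
        match b with
        | .tr _ => simpa using tight_zero
        | .diag _ => simpa using tight_zero
        | .quad i' w' j' =>
          simp only [atomWeight] at hl
          have h0 := ih0 l'' (by omega)
          refine (((tight_quadPoly_mul hρ hs j (w.reverse ++ w') j' l'' (ih0 _ ?_) h0).smul
            (hρ i i')).add ((tight_quadPoly_mul hρ hs i' (w' ++ w) j l'' (ih0 _ ?_) h0).smul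
            (hρ i j'))).congr fun x => ?_
          · simp only [List.map_cons, List.sum_cons, atomWeight, List.length_append,
              List.length_reverse]
            omega
          · simp only [List.map_cons, List.sum_cons, atomWeight, List.length_append]
            omega
          · simp only [smul_eq_C_mul]
            ring

end Tightness

/-! ### Asymptotic Gaussianity of the Chebyshev forms -/

section Slots

open MvPolynomial

variable {Θ ι : Type*} {n : Θ → ℕ} {ρ : Θ → ι → ι → ℝ}
  {E : ∀ x, MvPolynomial (ι × Sym2 (Fin (n x + 1))) ℝ →ₗ[ℝ] ℝ}

/-- The limiting covariance of two quadratic forms. -/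
noncomputable def quadCov (ρ : ι → ι → ℝ) (i : ι) (w : List ι) (j i' : ι) (w' : List ι)
    (j' : ι) : ℝ :=
  ρ i i' * (ρ j j' * tau ρ (w.reverse ++ w')) + ρ i j' * (ρ i' j * tau ρ (w' ++ w))

/-- The leading part of `quadDeriv`. -/
noncomputable def quadMain (ρ : ι → ι → ℝ) (i : ι) (w : List ι) (j : ι) :
    Derivation ℝ (MvPolynomial (Atom ι) ℝ) (MvPolynomial (Atom ι) ℝ) :=
  mkDerivation ℝ fun b => match b with
    | .quad i' w' j' => C (quadCov ρ i w j i' w' j')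
    | .tr _ => 0
    | .diag _ => 0

/-- The lower order part of `quadDeriv`. -/
noncomputable def quadRest (ρ : ι → ι → ℝ) (i : ι) (w : List ι) (j : ι) :
    Derivation ℝ (MvPolynomial (Atom ι) ℝ) (MvPolynomial (Atom ι) ℝ) :=
  mkDerivation ℝ fun b => match b with
    | .quad i' w' j' => ρ i i' • X (.quad j (w.reverse ++ w') j') +
        ρ i j' • X (.quad i' (w' ++ w) j)
    | .tr _ => 0
    | .diag _ => 0

lemma quadDeriv_eq (ρ : ι → ι → ℝ) (s : ℝ) (i : ι) (w : List ι) (j : ι) :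
    quadDeriv ρ s i w j = quadMain ρ i w j + s • quadRest ρ i w j := by
  refine derivation_ext fun b => ?_
  rw [Derivation.add_apply, Derivation.smul_apply, quadDeriv, quadMain, quadRest,
    mkDerivation_X, mkDerivation_X, mkDerivation_X]
  match b with
  | .quad i' w' j' =>
    simp only [quadPoly, quadCov, smul_eq_C_mul, C_mul, C_add]
    ring
  | .tr _ => simp
  | .diag _ => simp

theorem tight_atom (hn : ∀ x, n x ≠ 0) (hρ : ∀ i j, ∃ C, ∀ x, |ρ x i j| ≤ C)
    (hE : ∀ x, IsGaussianFunctional (goeCov (ρ x)) (E x)) (p : MvPolynomial (Atom ι) ℝ) :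
    Tight (atomExp ρ E) fun _ => p := by
  induction p using lprod_induction with
  | hl l => exact tight_lprod_atom hn hρ hE l
  | hadd p q hp hq => exact hp.add hq
  | hsmul r p hp => exact hp.smul ⟨|r|, fun _ => le_rfl⟩

lemma tight_quadRest (hn : ∀ x, n x ≠ 0) (hρ : ∀ i j, ∃ C, ∀ x, |ρ x i j| ≤ C)
    (hE : ∀ x, IsGaussianFunctional (goeCov (ρ x)) (E x)) (i : ι) (w : List ι) (j : ι)
    (p : MvPolynomial (Atom ι) ℝ) :
    Tight (atomExp ρ E) fun x => quadRest (ρ x) i w j p := by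
  induction p using lprod_induction with
  | hl l =>
    have := tight_lprod_mul_derivation (F := atomExp ρ E) (fun x => quadRest (ρ x) i w j)
      atomWeight ((l.map atomWeight).sum) (fun b l' _ => ?_) l [] (by simp)
    · simpa using this
    simp only [quadRest, mkDerivation_X]
    match b with
    | .tr _ => simpa using tight_zero
    | .diag _ => simpa using tight_zero
    | .quad i' w' j' =>
      refine (((tight_atom hn hρ hE (X (.quad j (w.reverse ++ w') j') * lprod l')).smul
        (hρ i i')).add ((tight_atom hn hρ hE (X (.quad i' (w' ++ w) j) * lprod l')).smul
        (hρ i j'))).congr fun x => ?_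
      simp only [smul_eq_C_mul]
      ring
  | hadd p q hp hq => simpa using hp.add hq
  | hsmul r p hp => simpa using hp.smul ⟨|r|, fun _ => le_rfl⟩

/-- The exact Schwinger--Dyson equation is the leading derivation plus `n^{-1/2}` times a trace term
and `quadRest`, and both of these have bounded expectation. -/
lemma asymptotic_ibp_quad (hn : ∀ x, n x ≠ 0) (hρ : ∀ i j, ∃ C, ∀ x, |ρ x i j| ≤ C)
    (hE : ∀ x, IsGaussianFunctional (goeCov (ρ x)) (E x)) (i : ι) (w : List ι) (j : ι)
    (p : MvPolynomial (Atom ι) ℝ) :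
    ∃ C, ∀ x, |atomExp ρ E x (X (.quad i w j) * p) - atomExp ρ E x (quadMain (ρ x) i w j p)| ≤
      C * (√(n x : ℝ))⁻¹ := by
  obtain ⟨C, hC⟩ := ((tight_atom hn hρ hE (X (.tr w) * p)).smul (hρ i j)).add
    (tight_quadRest hn hρ hE i w j p)
  refine ⟨C, fun x => ?_⟩
  have h : atomExp ρ E x (X (.quad i w j) * p) =
      atomExp ρ E x (((√(n x : ℝ))⁻¹ * ρ x i j) • (X (.tr w) * p) +
        quadDeriv (ρ x) (√(n x : ℝ))⁻¹ i w j p) := schwingerDyson_quad (hE x) (hn x) i w j p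
  have e : ((√(n x : ℝ))⁻¹ * ρ x i j) • (X (.tr w) * p) +
      quadDeriv (ρ x) (√(n x : ℝ))⁻¹ i w j p = quadMain (ρ x) i w j p +
        (√(n x : ℝ))⁻¹ • (ρ x i j • (X (.tr w) * p) + quadRest (ρ x) i w j p) := by
    rw [quadDeriv_eq, Derivation.add_apply, Derivation.smul_apply, smul_add, mul_smul]
    ring
  rw [h, e, map_add, add_sub_cancel_left, map_smul, smul_eq_mul, abs_mul, mul_comm,
    abs_of_nonneg (by positivity : (0 : ℝ) ≤ (√(n x : ℝ))⁻¹)]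
  exact mul_le_mul_of_nonneg_right (hC x) (by positivity)

open Polynomial in
/-- The centered quadratic form of the column `i` for a polynomial in the minor `i`. -/
noncomputable def quadLin (i : ι) : ℝ[X] →ₗ[ℝ] MvPolynomial (Atom ι) ℝ :=
  (Polynomial.basisMonomials ℝ).constr ℝ fun k =>
    MvPolynomial.X (.quad i (List.replicate k i) i)

open Polynomial in
/-- The leading part of the integration by parts for `quadLin`. -/
noncomputable def quadMainLin (ρ : ι → ι → ℝ) (i : ι) :
    ℝ[X] →ₗ[ℝ] Derivation ℝ (MvPolynomial (Atom ι) ℝ) (MvPolynomial (Atom ι) ℝ) :=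
  (Polynomial.basisMonomials ℝ).constr ℝ fun k => quadMain ρ i (List.replicate k i) i

lemma quadMainLin_diag (ρ : ι → ι → ℝ) (i j : ι) (f : Polynomial ℝ) :
    quadMainLin ρ i f (X (.diag j)) = 0 := by
  induction f using polynomial_lin_ind with
  | hadd f g hf hg => simp [hf, hg]
  | hsmul r f hf => simp [hf]
  | hX k => rw [quadMainLin, constr_X_pow, quadMain, mkDerivation_X]

lemma diagDeriv_quadLin (ρ : ι → ι → ℝ) (i j : ι) (f : Polynomial ℝ) :
    diagDeriv ρ i (quadLin j f) = 0 := by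
  induction f using polynomial_lin_ind with
  | hadd f g hf hg => simp [hf, hg]
  | hsmul r f hf => simp [hf]
  | hX k => rw [quadLin, constr_X_pow, diagDeriv, mkDerivation_X]

/-- The two columns of one form are contracted with the two columns of the other in two ways. Each
gives `ρ i j ^ 2`, and the powers are glued to `i^a j^b` or to `j^b i^a`. -/
lemma quadMainLin_quadLin (ρ : ι → ι → ℝ) (hρ : ∀ i j, ρ i j = ρ j i) (i j : ι)
    (f g : Polynomial ℝ) :
    quadMainLin ρ i f (quadLin j g) =
      C (ρ i j ^ 2 * tauBilin ρ i j f g + ρ i j ^ 2 * tauBilin ρ j i g f) := by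
  induction f using polynomial_lin_ind with
  | hadd f f' hf hf' =>
    simp only [map_add, Derivation.add_apply, hf, hf', LinearMap.add_apply, mul_add]
    rw [← C_add, ← C_add, ← C_add]
    simp only [map_add]
    ring
  | hsmul r f hf =>
    simp only [map_smul, Derivation.smul_apply, hf, LinearMap.smul_apply, smul_eq_mul]
    rw [smul_eq_C_mul, ← C_mul]
    congr 1
    ring
  | hX a =>
    induction g using polynomial_lin_ind with
    | hadd f f' hf hf' =>
      simp only [map_add, hf, hf', LinearMap.add_apply, mul_add]
      ring
    | hsmul r f hf =>
      simp only [map_smul, Derivation.map_smul, hf, LinearMap.smul_apply, smul_eq_mul]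
      rw [smul_eq_C_mul, ← C_mul]
      congr 1
      ring
    | hX b =>
      rw [quadMainLin, constr_X_pow, quadLin, constr_X_pow, quadMain, mkDerivation_X]
      change C (quadCov ρ i (List.replicate a i) i j (List.replicate b j) j) = _
      rw [quadCov, tauBilin_X_pow, tauBilin_X_pow, List.reverse_replicate, hρ j i]
      congr 1
      ring

lemma asymptotic_ibp_quadLin (hn : ∀ x, n x ≠ 0) (hρ : ∀ i j, ∃ C, ∀ x, |ρ x i j| ≤ C)
    (hE : ∀ x, IsGaussianFunctional (goeCov (ρ x)) (E x)) (i : ι) (f : Polynomial ℝ)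
    (p : MvPolynomial (Atom ι) ℝ) :
    ∃ C, ∀ x, |atomExp ρ E x (quadLin i f * p) - atomExp ρ E x (quadMainLin (ρ x) i f p)| ≤
      C * (√(n x : ℝ))⁻¹ := by
  induction f using polynomial_lin_ind with
  | hadd f g hf hg =>
    obtain ⟨C, hC⟩ := hf
    obtain ⟨C', hC'⟩ := hg
    refine ⟨C + C', fun x => ?_⟩
    rw [map_add, map_add, Derivation.add_apply, add_mul, map_add, map_add, add_sub_add_comm,
      add_mul]
    exact (abs_add_le _ _).trans (add_le_add (hC x) (hC' x))
  | hsmul r f hf =>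
    obtain ⟨C, hC⟩ := hf
    refine ⟨|r| * C, fun x => ?_⟩
    rw [map_smul, map_smul, Derivation.smul_apply, smul_mul_assoc, map_smul, map_smul,
      ← smul_sub, smul_eq_mul, abs_mul, mul_assoc]
    exact mul_le_mul_of_nonneg_left (hC x) (abs_nonneg r)
  | hX k =>
    simp only [quadLin, quadMainLin, constr_X_pow]
    exact asymptotic_ibp_quad hn hρ hE i _ i p

open Polynomial.Chebyshev in
/-- The entries of the tridiagonal model: level `0` is the corner entry and level `m + 1` is the
centered quadratic form of `P_m`. -/
noncomputable def slotPoly (κ : ι → ℕ) (i : ι) : MvPolynomial (Atom ι) ℝ :=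
  match κ i with
  | 0 => X (.diag i)
  | m + 1 => quadLin i (S ℝ (m : ℤ))

open Polynomial.Chebyshev in
/-- The derivations of the asymptotic integration by parts for `slotPoly`. -/
noncomputable def slotDeriv (ρ : ι → ι → ℝ) (κ : ι → ℕ) (i : ι) :
    Derivation ℝ (MvPolynomial (Atom ι) ℝ) (MvPolynomial (Atom ι) ℝ) :=
  match κ i with
  | 0 => diagDeriv ρ i
  | m + 1 => quadMainLin ρ i (S ℝ (m : ℤ))

/-- The limiting covariance of the entries. -/
noncomputable def slotCov (ρ : ι → ι → ℝ) (κ : ι → ℕ) (i j : ι) : ℝ :=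
  2 * if κ i = κ j then ρ i j ^ (κ i + 1) else 0

/-- For the forms of `P_m` the column contractions contribute `ρ²` and Chebyshev orthogonality
`ρ^m`, twice; with level `m + 1` this is `2 ρ^{κ+1}`, which also fits the corner at level `0`. -/
lemma slotDeriv_slotPoly (ρ : ι → ι → ℝ) (hρ : ∀ i j, ρ i j = ρ j i) (h1 : ∀ i, ρ i i = 1)
    (κ : ι → ℕ) (i j : ι) :
    slotDeriv ρ κ i (slotPoly κ j) = algebraMap ℝ _ (slotCov ρ κ i j) := by
  rw [slotDeriv, slotPoly, slotCov, algebraMap_eq]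
  rcases κ i with _ | m <;> rcases κ j with _ | l
  · simp [diagDeriv]
  · simp [diagDeriv_quadLin]
  · simp [quadMainLin_diag]
  · simp only
    rw [quadMainLin_quadLin ρ hρ, tauBilin_chebyshev ρ i j (h1 i) (h1 j),
      tauBilin_chebyshev ρ j i (h1 j) (h1 i), hρ j i]
    congr 1
    by_cases h : m = l
    · subst h
      simp only [if_true]
      ring
    · simp [h, Ne.symm h]

lemma asymptotic_ibp_slotPoly (hn : ∀ x, n x ≠ 0) (hρ : ∀ i j, ∃ C, ∀ x, |ρ x i j| ≤ C)
    (hE : ∀ x, IsGaussianFunctional (goeCov (ρ x)) (E x)) (κ : ι → ℕ) (i : ι)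
    (p : MvPolynomial (Atom ι) ℝ) :
    ∃ C, ∀ x, |atomExp ρ E x (slotPoly κ i * p) - atomExp ρ E x (slotDeriv (ρ x) κ i p)| ≤
      C * (√(n x : ℝ))⁻¹ := by
  unfold slotPoly slotDeriv
  rcases κ i with _ | m
  · refine ⟨0, fun x => ?_⟩
    have h : atomExp ρ E x (X (.diag i) * p) = atomExp ρ E x (diagDeriv (ρ x) i p) :=
      schwingerDyson_diag (hE x) i p
    simp [h]
  · exact asymptotic_ibp_quadLin hn hρ hE i _ p

lemma derivation_prod_eq_zero {A : Type*} [CommRing A] [Algebra ℝ A] (D : Derivation ℝ A A)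
    {j : ℕ} (g : Fin j → A) (h : ∀ i, D (g i) = 0) : D (∏ i, g i) = 0 := by
  cases j with
  | zero => simp
  | succ j => simp [derivation_prod_fin, h]

lemma slotCov_bounded (hρ : ∀ i j, ∃ C, ∀ x, |ρ x i j| ≤ C) (κ : ι → ℕ) (i j : ι) :
    ∃ C, ∀ x, |slotCov (ρ x) κ i j| ≤ C := by
  obtain ⟨C, hC⟩ := hρ i j
  refine ⟨2 * |C| ^ (κ i + 1), fun x => ?_⟩
  rw [slotCov, abs_mul, abs_of_pos (by norm_num : (0 : ℝ) < 2)]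
  split_ifs
  · rw [abs_pow]
    have := (hC x).trans (le_abs_self C)
    gcongr
  · simp only [abs_zero, mul_zero]
    positivity

/-- Two blocks of a family that satisfies asymptotic integration by parts and has no covariance
between the blocks. -/
theorem wick_asymptotic_two {Θ S A : Type*} [CommRing A] [Algebra ℝ A] (F : Θ → A →ₗ[ℝ] ℝ)
    (Y : S → A) (c : Θ → S → S → ℝ) (D : Θ → S → Derivation ℝ A A) (ε : Θ → ℝ)
    (h1 : ∀ x, F x 1 = 1)
    (hD : ∀ x s s', D x s (Y s') = algebraMap ℝ A (c x s s'))
    (hF : ∀ s p, ∃ C, ∀ x, |F x (Y s * p) - F x (D x s p)| ≤ C * ε x)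
    (hc : ∀ s s', ∃ C, ∀ x, |c x s s'| ≤ C) {j j' : ℕ} (f : Fin j → S) (f' : Fin j' → S)
    (hff' : ∀ a b x, c x (f a) (f' b) = 0) :
    ∃ C, ∀ x, |F x ((∏ i, Y (f i)) * ∏ i, Y (f' i)) -
      wickFin (fun a b => c x (f a) (f b)) * wickFin (fun a b => c x (f' a) (f' b))| ≤
      C * ε x := by
  -- The second block plays the passive factor `G`: the derivations of the first block kill it
  -- because the cross covariances vanish.
  obtain ⟨C₁, hC₁⟩ := wick_asymptotic F Y c D ε hD hF hc (∏ i, Y (f' i)) j f fun i x =>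
    derivation_prod_eq_zero _ _ fun b => by rw [hD, hff', map_zero]
  obtain ⟨C₂, hC₂⟩ := wick_asymptotic F Y c D ε hD hF hc 1 j' f' fun i x => by simp
  obtain ⟨K, hK⟩ := wickFin_bounded c hc f
  refine ⟨C₁ + K * C₂, fun x => ?_⟩
  have h2 := hC₂ x
  rw [mul_one, h1, mul_one] at h2
  have e : F x ((∏ i, Y (f i)) * ∏ i, Y (f' i)) -
      wickFin (fun a b => c x (f a) (f b)) * wickFin (fun a b => c x (f' a) (f' b)) =
      (F x ((∏ i, Y (f i)) * ∏ i, Y (f' i)) -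
        wickFin (fun a b => c x (f a) (f b)) * F x (∏ i, Y (f' i))) +
      wickFin (fun a b => c x (f a) (f b)) *
        (F x (∏ i, Y (f' i)) - wickFin (fun a b => c x (f' a) (f' b))) := by ring
  rw [e, add_mul, mul_assoc]
  refine (abs_add_le _ _).trans (add_le_add (hC₁ x) ?_)
  rw [abs_mul]
  exact mul_le_mul (hK x) h2 (abs_nonneg _) ((abs_nonneg _).trans (hK x))

/-- Mixed moments of two blocks of entries of different levels. -/
theorem moments_slotPoly (hn : ∀ x, n x ≠ 0) (hρ : ∀ i j, ∃ C, ∀ x, |ρ x i j| ≤ C)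
    (hsymm : ∀ x i j, ρ x i j = ρ x j i) (hone : ∀ x i, ρ x i i = 1)
    (hE : ∀ x, IsGaussianFunctional (goeCov (ρ x)) (E x)) (κ : ι → ℕ) {j j' : ℕ}
    (f : Fin j → ι) (f' : Fin j' → ι) (hff' : ∀ a b, κ (f a) ≠ κ (f' b)) :
    ∃ C, ∀ x, |atomExp ρ E x ((∏ i, slotPoly κ (f i)) * ∏ i, slotPoly κ (f' i)) -
      wickFin (fun a b => slotCov (ρ x) κ (f a) (f b)) *
        wickFin (fun a b => slotCov (ρ x) κ (f' a) (f' b))| ≤ C * (√(n x : ℝ))⁻¹ :=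
  wick_asymptotic_two (atomExp ρ E) (slotPoly κ) (fun x => slotCov (ρ x) κ)
    (fun x => slotDeriv (ρ x) κ) (fun x => (√(n x : ℝ))⁻¹)
    (fun x => by simp [atomExp, (hE x).map_one])
    (fun x s s' => slotDeriv_slotPoly (ρ x) (hsymm x) (hone x) κ s s')
    (asymptotic_ibp_slotPoly hn hρ hE κ) (slotCov_bounded hρ κ) f f'
    (fun a b x => by simp [slotCov, hff' a b])

end Slots

/-! ### Moments of the approximate entries -/

section Evaluation

open MvPolynomial

/-- The entry of a symmetric matrix at an unordered pair. -/
noncomputable def symEntry {d : ℕ} (A : Matrix (Fin d) (Fin d) ℝ) (e : Sym2 (Fin d)) : ℝ :=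
  A (Quot.out e).1 (Quot.out e).2

lemma mk_out {α : Type*} (e : Sym2 α) : s((Quot.out e).1, (Quot.out e).2) = e := Quot.out_eq e

lemma symEntry_mk {d : ℕ} {A : Matrix (Fin d) (Fin d) ℝ} (hA : A.IsSymm) (i j : Fin d) :
    symEntry A s(i, j) = A i j := by
  have h := mk_out s(i, j)
  rw [symEntry]
  rcases Sym2.eq_iff.1 h with ⟨h1, h2⟩ | ⟨h1, h2⟩
  · rw [h1, h2]
  · rw [h1, h2, hA.apply]

/-- The approximate entries, indexed by their level: `aTilde k` has level `2 k` and `bScaled k`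
has level `2 k + 1`. -/
noncomputable def levelEntry {n : ℕ} (κ : ℕ) (A : Matrix (Fin (n + 1)) (Fin (n + 1)) ℝ) : ℝ :=
  match κ with
  | 0 => A 0 0
  | m + 1 => √(n : ℝ) * chebForm m A - √(n : ℝ) * if m = 0 then 1 else 0

lemma aTilde_eq_levelEntry {n : ℕ} (k : ℕ) (A : Matrix (Fin (n + 1)) (Fin (n + 1)) ℝ) :
    aTilde k A = levelEntry (2 * k) A := by
  cases k with
  | zero => rfl
  | succ k =>
    have h : 2 * (k + 1) = (2 * k + 1) + 1 := by ring
    rw [aTilde, h, levelEntry]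
    simp

lemma bScaled_eq_levelEntry {n : ℕ} (k : ℕ) (A : Matrix (Fin (n + 1)) (Fin (n + 1)) ℝ) :
    bScaled k A = levelEntry (2 * k + 1) A := by
  have hd : (n : ℝ) / √(n : ℝ) = √(n : ℝ) := Real.div_sqrt
  rw [bScaled, levelEntry, bTildeSq]
  cases k with
  | zero =>
    rw [if_pos rfl, sub_div, mul_div_right_comm, hd]
    simp [chebForm]
  | succ k =>
    rw [if_neg (by omega), add_sub_cancel_left, mul_div_right_comm, hd]
    simp

variable {ι : Type*} {n : ℕ}

/-- The normalized minor without its zero row and column. -/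
noncomputable def innerMinor (A : Matrix (Fin (n + 1)) (Fin (n + 1)) ℝ) :
    Matrix (Fin n) (Fin n) ℝ :=
  Matrix.of fun a b => (√(n : ℝ))⁻¹ * A a.succ b.succ

/-- The vector `theta` without its zero entry. -/
noncomputable def innerTheta (A : Matrix (Fin (n + 1)) (Fin (n + 1)) ℝ) : Fin n → ℝ :=
  fun a => (√(n : ℝ))⁻¹ * A a.succ 0

lemma theta_eq (A : Matrix (Fin (n + 1)) (Fin (n + 1)) ℝ) :
    theta A = Fin.cons 0 (innerTheta A) := by
  ext a
  cases a using Fin.cases with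
  | zero => simp [theta]
  | succ a => simp [theta, innerTheta, Fin.succ_ne_zero, div_eq_inv_mul]

/-- The zero row and column keep the first coordinate equal to zero, so the computation takes place
in the `n × n` block. -/
lemma minor_pow_mulVec_theta (A : Matrix (Fin (n + 1)) (Fin (n + 1)) ℝ) (k : ℕ) :
    ((√(n : ℝ))⁻¹ • minor A) ^ k *ᵥ theta A =
      Fin.cons 0 (innerMinor A ^ k *ᵥ innerTheta A) := by
  induction k with
  | zero => simp [theta_eq]
  | succ k ih =>
    rw [pow_succ', ← Matrix.mulVec_mulVec, ih, pow_succ', ← Matrix.mulVec_mulVec]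
    generalize innerMinor A ^ k *ᵥ innerTheta A = v
    ext a
    cases a using Fin.cases with
    | zero => simp [Matrix.mulVec, dotProduct, minor]
    | succ a =>
      simp [Matrix.mulVec, dotProduct, minor, Fin.sum_univ_succ, innerMinor, Fin.succ_ne_zero]

lemma theta_dot_minor_pow (A : Matrix (Fin (n + 1)) (Fin (n + 1)) ℝ) (k : ℕ) :
    theta A ⬝ᵥ (((√(n : ℝ))⁻¹ • minor A) ^ k *ᵥ theta A) =
      innerTheta A ⬝ᵥ (innerMinor A ^ k *ᵥ innerTheta A) := by
  rw [minor_pow_mulVec_theta, theta_eq]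
  simp [dotProduct, Fin.sum_univ_succ]

/-- The values of the variables for a family of symmetric matrices. -/
noncomputable def entryAssign (A : ι → Matrix (Fin (n + 1)) (Fin (n + 1)) ℝ)
    (u : ι × Sym2 (Fin (n + 1))) : ℝ :=
  symEntry (A u.1) u.2

lemma eval_quadVar (A : ι → Matrix (Fin (n + 1)) (Fin (n + 1)) ℝ) (hA : ∀ i, (A i).IsSymm)
    (i : ι) (k : ℕ) :
    eval (entryAssign A) (quadVar i (List.replicate k i) i) =
      theta (A i) ⬝ᵥ (((√(n : ℝ))⁻¹ • minor (A i)) ^ k *ᵥ theta (A i)) := by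
  have hcol : (eval (entryAssign A)) ∘ (colVar (n := n) i) = innerTheta (A i) := by
    ext a
    simp only [Function.comp_apply, colVar, smul_eval, eval_X, entryAssign, symEntry_mk (hA i),
      innerTheta]
    rw [(hA i).apply]
  have hW : (minorVar (n := n) i).map (eval (entryAssign A)) = innerMinor (A i) := by
    ext a b
    simp [minorVar, entryAssign, symEntry_mk (hA i), innerMinor]
  have hword : (word (minorVar (n := n)) (List.replicate k i)).map (eval (entryAssign A)) =
      innerMinor (A i) ^ k := by
    rw [word, List.map_replicate, List.prod_replicate, ← hW]
    exact map_pow (RingHom.mapMatrix (eval (entryAssign A))) _ k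
  rw [theta_dot_minor_pow, quadVar, RingHom.map_dotProduct, hcol, ← hword, ← hcol]
  congr 1
  ext a
  simp [RingHom.map_mulVec]

lemma eval_quadLin (ρ : ι → ι → ℝ) (h1 : ∀ i, ρ i i = 1)
    (A : ι → Matrix (Fin (n + 1)) (Fin (n + 1)) ℝ) (hA : ∀ i, (A i).IsSymm)
    (i : ι) (f : Polynomial ℝ) :
    eval (entryAssign A) (aeval (atomVal ρ) (quadLin i f)) =
      √(n : ℝ) * (theta (A i) ⬝ᵥ
        (Polynomial.aeval ((√(n : ℝ))⁻¹ • minor (A i)) f *ᵥ theta (A i))) -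
      √(n : ℝ) * tauLin ρ i f := by
  induction f using polynomial_lin_ind with
  | hadd f g hf hg =>
    simp only [map_add, hf, hg, Matrix.add_mulVec, dotProduct_add]
    ring
  | hsmul r f hf =>
    simp only [map_smul, smul_eval, hf, Matrix.smul_mulVec, dotProduct_smul, smul_eq_mul]
    ring
  | hX k =>
    rw [quadLin, constr_X_pow, aeval_X, tauLin_X_pow, map_pow, Polynomial.aeval_X]
    simp only [atomVal, map_sub, smul_eval, eval_quadVar A hA, eval_C, h1, one_mul]

lemma eval_slotPoly (ρ : ι → ι → ℝ) (h1 : ∀ i, ρ i i = 1)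
    (A : ι → Matrix (Fin (n + 1)) (Fin (n + 1)) ℝ) (hA : ∀ i, (A i).IsSymm) (κ : ι → ℕ)
    (i : ι) :
    eval (entryAssign A) (aeval (atomVal ρ) (slotPoly κ i)) = levelEntry (κ i) (A i) := by
  rw [slotPoly]
  rcases κ i with _ | m
  · simp [levelEntry, atomVal, entryAssign, symEntry_mk (hA i)]
  · simp only [levelEntry]
    rw [eval_quadLin ρ h1 A hA, (chebyshev_diffQuot_tauLin ρ i (h1 i) m).2, chebForm]

/-- The correlation function of the Ornstein--Uhlenbeck process at the times `t`. -/
noncomputable def ouCorr (t : ι → ℝ≥0) (i j : ι) : ℝ := Real.exp (-|(t j : ℝ) - (t i : ℝ)|)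

lemma ouCorr_comm (t : ι → ℝ≥0) (i j : ι) : ouCorr t i j = ouCorr t j i := by
  rw [ouCorr, ouCorr, abs_sub_comm]

lemma ouCorr_self (t : ι → ℝ≥0) (i : ι) : ouCorr t i i = 1 := by
  simp [ouCorr]

lemma abs_ouCorr_le (t : ι → ℝ≥0) (i j : ι) : |ouCorr t i j| ≤ 1 := by
  rw [ouCorr, abs_of_pos (Real.exp_pos _), Real.exp_le_one_iff]
  simp

variable {Ω : Type*} [MeasurableSpace Ω] {P : Measure Ω}

lemma isGaussianProcess_entryAssign {M : ℝ≥0 → Ω → Matrix (Fin (n + 1)) (Fin (n + 1)) ℝ}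
    (hM : IsGOEProcess M P) (t : ι → ℝ≥0) :
    IsGaussianProcess (fun u ω => entryAssign (fun i => M (t i) ω) u) P :=
  hM.gaussian.comp_right fun u : ι × Sym2 (Fin (n + 1)) =>
    (t u.1, (Quot.out u.2).1, (Quot.out u.2).2)

lemma isGaussianFunctional_entryAssign [Countable ι]
    {M : ℝ≥0 → Ω → Matrix (Fin (n + 1)) (Fin (n + 1)) ℝ} (hM : IsGOEProcess M P) (t : ι → ℝ≥0) :
    IsGaussianFunctional (goeCov (ouCorr t)) (expect (isGaussianProcess_entryAssign hM t)) := by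
  refine isGaussianFunctional_expect _ (fun u => hM.centered _ _ _) _ fun u v => ?_
  have h := hM.covariance (t u.1) (t v.1) (Quot.out u.2).1 (Quot.out u.2).2
    (Quot.out v.2).1 (Quot.out v.2).2
  rw [mk_out, mk_out] at h
  refine h.trans ?_
  rw [goeCov, ouCorr]
  by_cases huv : u.2 = v.2
  · rw [if_pos huv, if_pos huv]
    congr 1
    have hd : (Quot.out u.2).1 = (Quot.out u.2).2 ↔ u.2.IsDiag := by
      conv_rhs => rw [← mk_out u.2]
      exact Sym2.mk_isDiag_iff.symm
    by_cases h' : u.2.IsDiag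
    · rw [if_pos (hd.2 h'), if_pos h']
      norm_num
    · rw [if_neg (mt hd.1 h'), if_neg h']
      norm_num
  · rw [if_neg huv, if_neg huv]

/-- Mixed moments of two blocks of entries of different levels, uniformly in the times. -/
theorem moments_levelEntry {M : (n : ℕ) → ℝ≥0 → Ω → Matrix (Fin (n + 1)) (Fin (n + 1)) ℝ}
    (hM : ∀ n, IsGOEProcess (M n) P) [Countable ι] (κ : ι → ℕ) {j j' : ℕ}
    (f : Fin j → ι) (f' : Fin j' → ι) (hff' : ∀ a b, κ (f a) ≠ κ (f' b)) :
    ∃ C, ∀ n : ℕ, 1 ≤ n → ∀ t : ι → ℝ≥0,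
      Integrable (fun ω => (∏ i, levelEntry (κ (f i)) (M n (t (f i)) ω)) *
          ∏ i, levelEntry (κ (f' i)) (M n (t (f' i)) ω)) P ∧
      |∫ ω, (∏ i, levelEntry (κ (f i)) (M n (t (f i)) ω)) *
          ∏ i, levelEntry (κ (f' i)) (M n (t (f' i)) ω) ∂P -
        wickFin (fun a b => slotCov (ouCorr t) κ (f a) (f b)) *
          wickFin (fun a b => slotCov (ouCorr t) κ (f' a) (f' b))| ≤ C / √(n : ℝ) := by
  -- The parameter contains the size and all times, so the constant obtained is uniform in both.
  let Θ := {n : ℕ // 1 ≤ n} × (ι → ℝ≥0)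
  obtain ⟨C, hC⟩ := moments_slotPoly (Θ := Θ) (n := fun x => x.1.1)
    (ρ := fun x => ouCorr x.2)
    (E := fun x => expect (isGaussianProcess_entryAssign (hM x.1.1) x.2))
    (fun x => Nat.one_le_iff_ne_zero.1 x.1.2) (fun i j => ⟨1, fun x => abs_ouCorr_le x.2 i j⟩)
    (fun x => ouCorr_comm x.2) (fun x => ouCorr_self x.2)
    (fun x => isGaussianFunctional_entryAssign (hM x.1.1) x.2) κ f f' hff'
  refine ⟨C, fun n hn t => ?_⟩
  have heval : ∀ ω, (∏ i, levelEntry (κ (f i)) (M n (t (f i)) ω)) *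
      ∏ i, levelEntry (κ (f' i)) (M n (t (f' i)) ω) =
      eval (entryAssign fun i => M n (t i) ω) (aeval (atomVal (ouCorr t))
        ((∏ i, slotPoly κ (f i)) * ∏ i, slotPoly κ (f' i))) := by
    intro ω
    simp only [map_mul, map_prod, eval_slotPoly (ouCorr t) (ouCorr_self t)
      (fun i => M n (t i) ω) fun i => (hM n).isSymm (t i) ω]
  simp only [heval]
  refine ⟨integrable_eval (isGaussianProcess_entryAssign (hM n) t) _, ?_⟩
  rw [div_eq_mul_inv]
  exact hC (⟨n, hn⟩, t)

end Evaluation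

/-! ### The limit process -/

section LimitProcess

open MvPolynomial

/-- Level `2 k` carries the exponent `2 k + 1 = 2 (k + 1) - 1`. -/
lemma slotCov_rateA {ι : Type*} (t : ι → ℝ≥0) (κ : ι → ℕ) (i j : ι) (k l : ℕ)
    (hi : κ i = 2 * k) (hj : κ j = 2 * l) :
    slotCov (ouCorr t) κ i j =
      2 * if k = l then Real.exp (-(rateA k * |(t i : ℝ) - (t j : ℝ)|)) else 0 := by
  rw [slotCov, hi, hj]
  congr 1
  refine if_congr (by omega) ?_ rfl
  rw [ouCorr, ← Real.exp_nat_mul, rateA, abs_sub_comm]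
  congr 1
  push_cast
  ring

lemma slotCov_rateB {ι : Type*} (t : ι → ℝ≥0) (κ : ι → ℕ) (i j : ι) (k l : ℕ)
    (hi : κ i = 2 * k + 1) (hj : κ j = 2 * l + 1) :
    slotCov (ouCorr t) κ i j =
      2 * if k = l then Real.exp (-(rateB k * |(t i : ℝ) - (t j : ℝ)|)) else 0 := by
  rw [slotCov, hi, hj]
  congr 1
  refine if_congr (by omega) ?_ rfl
  rw [ouCorr, ← Real.exp_nat_mul, rateB, abs_sub_comm]
  congr 1
  push_cast
  ring

/-- Independent Gaussian processes are jointly Gaussian. -/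
lemma isGaussianProcess_of_iIndepFun {Ω ι T : Type*} [MeasurableSpace Ω] [Finite ι]
    {P : Measure Ω} {X : ι → T → Ω → ℝ} (hX : ∀ i, IsGaussianProcess (X i) P)
    (hind : iIndepFun (fun i ω t => X i t ω) P) :
    IsGaussianProcess (fun (p : ι × T) ω => X p.1 p.2 ω) P where
  hasGaussianLaw I := by
    classical
    have := Fintype.ofFinite ι
    -- Over one common finite set of times the processes become independent Gaussian vectors, hence
    -- a jointly Gaussian family, from which the wanted coordinates are selected.
    let J : Finset T := I.image Prod.snd
    have h1 : iIndepFun (fun i ω => J.restrict (X i · ω)) P :=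
      hind.comp (fun _ f => J.restrict f) fun _ => Finset.measurable_restrict J
    have h2 := h1.hasGaussianLaw fun i => (hX i).hasGaussianLaw J
    let L : (ι → J → ℝ) →L[ℝ] (I → ℝ) :=
      ContinuousLinearMap.pi fun p : I =>
        (ContinuousLinearMap.proj (R := ℝ) (φ := fun _ : J => ℝ)
          ⟨p.1.2, Finset.mem_image_of_mem _ p.2⟩).comp
          (ContinuousLinearMap.proj (R := ℝ) (φ := fun _ : ι => J → ℝ) p.1.1)
    exact h2.map L

/-- The level of an entry of the vector `(A₁, …, A_K, B₁, …, B_K)`. -/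
def entryLevel {K : ℕ} : Fin K ⊕ Fin K → ℕ :=
  Sum.elim (fun k => 2 * (k : ℕ)) (fun k => 2 * (k : ℕ) + 1)

lemma entryLevel_injective {K : ℕ} : Function.Injective (entryLevel (K := K)) := by
  rintro (k | k) (l | l) h <;> simp only [entryLevel, Sum.elim_inl, Sum.elim_inr] at h
  · congr 1; ext; omega
  · omega
  · omega
  · congr 1; ext; omega

lemma rate_eq_entryLevel {K : ℕ} (c : Fin K ⊕ Fin K) :
    Sum.elim (fun k : Fin K => rateA k) (fun k : Fin K => rateB k) c =
      ((entryLevel c + 1 : ℕ) : ℝ) := by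
  rcases c with k | k <;> simp [entryLevel, rateA, rateB] <;> ring

lemma eq_sqrt_two_mul (x : ℝ) : x = √2 * (1 / √2 * x) := by
  have : √(2 : ℝ) ≠ 0 := by positivity
  field_simp

variable {Ω : Type*} [MeasurableSpace Ω] {P : Measure Ω} {K : ℕ}
  {E : Fin K ⊕ Fin K → ℝ≥0 → Ω → ℝ} {σ : Type*}

lemma isGaussianProcess_limit
    (hE : IsVectorOU (Sum.elim (fun k : Fin K => rateA k) (fun k : Fin K => rateB k))
      (fun c t ω => (1 / √2) * E c t ω) P) (a : σ → Fin K ⊕ Fin K) (t : σ → ℝ≥0) :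
    IsGaussianProcess (fun s ω => E (a s) (t s) ω) P := by
  have h := ((isGaussianProcess_of_iIndepFun (fun c => (hE.isOU c).gaussian) hE.indep).smul
    fun _ => √2).comp_right fun s : σ => (a s, t s)
  refine h.congr fun s => .of_forall fun ω => ?_
  exact (eq_sqrt_two_mul _).symm

lemma integral_limit_mul
    (hE : IsVectorOU (Sum.elim (fun k : Fin K => rateA k) (fun k : Fin K => rateB k))
      (fun c t ω => (1 / √2) * E c t ω) P) (a : σ → Fin K ⊕ Fin K) (t : σ → ℝ≥0) (s s' : σ) :
    ∫ ω, E (a s) (t s) ω * E (a s') (t s') ω ∂P =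
      slotCov (ouCorr t) (fun s => entryLevel (a s)) s s' := by
  have h2 : ∀ ω, E (a s) (t s) ω * E (a s') (t s') ω =
      2 * ((1 / √2 * E (a s) (t s) ω) * (1 / √2 * E (a s') (t s') ω)) := by
    intro ω
    have : √(2 : ℝ) ≠ 0 := by positivity
    field_simp
    rw [Real.sq_sqrt (by norm_num)]
  simp only [h2]
  rw [integral_const_mul, slotCov]
  congr 1
  simp only [entryLevel_injective.eq_iff]
  by_cases h : a s = a s'
  · rw [if_pos h, ← h, (hE.isOU (a s)).covariance, rate_eq_entryLevel, ouCorr,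
      ← Real.exp_nat_mul]
    congr 1
    ring
  · rw [if_neg h]
    have hind := (hE.indep.indepFun h).comp
      (measurable_pi_apply (X := fun _ : ℝ≥0 => ℝ) (t s))
      (measurable_pi_apply (X := fun _ : ℝ≥0 => ℝ) (t s'))
    have := hind.integral_mul_eq_mul_integral
      (((hE.isOU (a s)).gaussian.aemeasurable (t s)).aestronglyMeasurable)
      (((hE.isOU (a s')).gaussian.aemeasurable (t s')).aestronglyMeasurable)
    refine this.trans ?_
    have h0 := (hE.isOU (a s)).centered (t s)
    change (∫ ω, 1 / √2 * E (a s) (t s) ω ∂P) * _ = 0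
    rw [h0, zero_mul]

lemma isGaussianFunctional_limit [Countable σ]
    (hE : IsVectorOU (Sum.elim (fun k : Fin K => rateA k) (fun k : Fin K => rateB k))
      (fun c t ω => (1 / √2) * E c t ω) P) (a : σ → Fin K ⊕ Fin K) (t : σ → ℝ≥0) :
    IsGaussianFunctional (slotCov (ouCorr t) fun s => entryLevel (a s))
      (expect (isGaussianProcess_limit hE a t)) := by
  refine isGaussianFunctional_expect _ (fun s => ?_) _ (integral_limit_mul hE a t)
  rw [integral_congr_ae (.of_forall fun ω => eq_sqrt_two_mul (E (a s) (t s) ω)),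
    integral_const_mul, (hE.isOU (a s)).centered, mul_zero]

/-- Isserlis' theorem for two blocks of variables without covariance between the blocks. -/
theorem IsGaussianFunctional.wick {c : σ → σ → ℝ} {F : MvPolynomial σ ℝ →ₗ[ℝ] ℝ}
    (hF : IsGaussianFunctional c F) {j j' : ℕ} (f : Fin j → σ) (f' : Fin j' → σ)
    (hff' : ∀ a b, c (f a) (f' b) = 0) :
    F ((∏ i, X (f i)) * ∏ i, X (f' i)) =
      wickFin (fun a b => c (f a) (f b)) * wickFin (fun a b => c (f' a) (f' b)) := by
  -- Exact integration by parts is the asymptotic version with error `ε = 0`.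
  obtain ⟨C, hC⟩ := wick_asymptotic_two (Θ := Unit) (fun _ => F) X (fun _ => c)
    (fun _ => gaussDeriv c) (fun _ => 0) (fun _ => hF.map_one)
    (fun _ s s' => by rw [gaussDeriv_X, algebraMap_eq])
    (fun s p => ⟨0, fun _ => by rw [hF.ibp]; simp⟩) (fun s s' => ⟨_, fun _ => le_rfl⟩) f f'
    (fun a b _ => hff' a b)
  have := hC ()
  rw [mul_zero, abs_nonpos_iff, sub_eq_zero] at this
  exact this

/-- The mixed moments of the limit process. -/
theorem moments_limit
    (hE : IsVectorOU (Sum.elim (fun k : Fin K => rateA k) (fun k : Fin K => rateB k))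
      (fun c t ω => (1 / √2) * E c t ω) P) (j₁ j₂ : ℕ) (k : Fin j₁ → Fin K)
    (k' : Fin j₂ → Fin K) (t : Fin j₁ → ℝ≥0) (t' : Fin j₂ → ℝ≥0) :
    Integrable (fun ω => (∏ i, E (Sum.inl (k i)) (t i) ω) *
          ∏ i, E (Sum.inr (k' i)) (t' i) ω) P ∧
        ∫ ω, (∏ i, E (Sum.inl (k i)) (t i) ω) * ∏ i, E (Sum.inr (k' i)) (t' i) ω ∂P =
          wickSum rateA (fun i => (k i : ℕ)) t * wickSum rateB (fun i => (k' i : ℕ)) t' := by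
  let a : Fin j₁ ⊕ Fin j₂ → Fin K ⊕ Fin K := Sum.map k k'
  have hG := isGaussianProcess_limit hE a (Sum.elim t t')
  have hF := isGaussianFunctional_limit hE a (Sum.elim t t')
  have heval : ∀ ω, (∏ i, E (Sum.inl (k i)) (t i) ω) * ∏ i, E (Sum.inr (k' i)) (t' i) ω =
      eval (fun s => E (a s) (Sum.elim t t' s) ω)
        ((∏ i, X (Sum.inl i)) * ∏ i, X (Sum.inr i)) := by
    intro ω
    simp [a]
  simp only [heval]
  refine ⟨integrable_eval hG _, ?_⟩
  refine (hF.wick Sum.inl Sum.inr fun b b' => ?_).trans ?_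
  · rw [slotCov, if_neg, mul_zero]
    simp only [a, entryLevel, Sum.map_inl, Sum.map_inr, Sum.elim_inl, Sum.elim_inr]
    omega
  · rw [wickSum_eq_wickFin, wickSum_eq_wickFin]
    congr 2
    · ext b b'
      exact slotCov_rateA _ _ _ _ _ _ rfl rfl
    · ext b b'
      exact slotCov_rateB _ _ _ _ _ _ rfl rfl

/-- The mixed moments of the approximate entries. -/
theorem moments_approx {M : (n : ℕ) → ℝ≥0 → Ω → Matrix (Fin (n + 1)) (Fin (n + 1)) ℝ}
    (hM : ∀ n, IsGOEProcess (M n) P) (j₁ j₂ : ℕ) (k : Fin j₁ → ℕ) (k' : Fin j₂ → ℕ) :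
    ∃ C : ℝ, ∀ (n : ℕ), 1 ≤ n → ∀ (t : Fin j₁ → ℝ≥0) (t' : Fin j₂ → ℝ≥0),
        Integrable (fun ω => (∏ i, aTilde (k i) (M n (t i) ω)) *
          ∏ i, bScaled (k' i) (M n (t' i) ω)) P ∧
        |(∫ ω, (∏ i, aTilde (k i) (M n (t i) ω)) * ∏ i, bScaled (k' i) (M n (t' i) ω) ∂P) -
          wickSum rateA k t * wickSum rateB k' t'| ≤ C / √(n : ℝ) := by
  -- Diagonal entries occupy the even levels and off-diagonal ones the odd levels, so the two blocks
  -- share no level.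
  let κ : Fin j₁ ⊕ Fin j₂ → ℕ := Sum.elim (fun i => 2 * k i) (fun i => 2 * k' i + 1)
  obtain ⟨C, hC⟩ := moments_levelEntry hM κ Sum.inl Sum.inr fun a b => by
    simp only [κ, Sum.elim_inl, Sum.elim_inr]
    omega
  refine ⟨C, fun n hn t t' => ?_⟩
  have h := hC n hn (Sum.elim t t')
  have hA : (fun a b => slotCov (ouCorr (Sum.elim t t')) κ (Sum.inl a) (Sum.inl b)) =
      fun a b => 2 * if k a = k b then
        Real.exp (-(rateA (k a) * |(t a : ℝ) - (t b : ℝ)|)) else 0 := by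
    ext a b
    exact slotCov_rateA _ _ _ _ _ _ rfl rfl
  have hB : (fun a b => slotCov (ouCorr (Sum.elim t t')) κ (Sum.inr a) (Sum.inr b)) =
      fun a b => 2 * if k' a = k' b then
        Real.exp (-(rateB (k' a) * |(t' a : ℝ) - (t' b : ℝ)|)) else 0 := by
    ext a b
    exact slotCov_rateB _ _ _ _ _ _ rfl rfl
  rw [hA, hB, ← wickSum_eq_wickFin, ← wickSum_eq_wickFin] at h
  simpa only [aTilde_eq_levelEntry, bScaled_eq_levelEntry] using! h

end LimitProcess

/-! ### Convergence in distribution from convergence of moments -/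

section Convergence

open MvPolynomial
open scoped Topology Nat

/-- The derivative of the remainder of order `m + 1` is `c` times that of order `m`, and the bounds
are related in the same way. A general unit `c` on the imaginary axis lets `-I` handle negative
arguments. -/
lemma norm_exp_sub_taylor_le (c : ℂ) (hre : c.re = 0) (hc : ‖c‖ = 1) (m : ℕ) {x : ℝ}
    (hx : 0 ≤ x) :
    ‖Complex.exp (x * c) - ∑ k ∈ Finset.range m, ((x : ℂ) * c) ^ k / (k ! : ℂ)‖ ≤
      x ^ m / (m ! : ℝ) := by
  induction m generalizing x with
  | zero => simp [Complex.norm_exp, hre]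
  | succ m ih =>
    have hd : ∀ y : ℝ, HasDerivAt (fun y : ℝ => Complex.exp (y * c) -
        ∑ k ∈ Finset.range (m + 1), ((y : ℂ) * c) ^ k / (k ! : ℂ))
        (c * (Complex.exp (y * c) - ∑ k ∈ Finset.range m, ((y : ℂ) * c) ^ k / (k ! : ℂ))) y := by
      intro y
      have h0 : HasDerivAt (fun y : ℝ => (y : ℂ) * c) c y := by
        simpa using (Complex.ofRealCLM.hasDerivAt (x := y)).mul_const c
      have h1 := h0.cexp.sub (HasDerivAt.fun_sum (u := Finset.range (m + 1))
        fun k _ => (h0.pow k).div_const (k ! : ℂ))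
      convert! h1 using 1
      rw [mul_sub, mul_comm c, Finset.sum_range_succ', Finset.mul_sum]
      congr 1
      simp only [Nat.cast_zero, zero_mul, zero_div, add_zero]
      refine Finset.sum_congr rfl fun k _ => ?_
      rw [Nat.factorial_succ]
      have : (k ! : ℂ) ≠ 0 := by exact_mod_cast k.factorial_ne_zero
      have : ((k : ℂ) + 1) ≠ 0 := by exact_mod_cast k.succ_ne_zero
      push_cast
      field_simp
    have hB : ∀ y : ℝ, HasDerivAt (fun y : ℝ => y ^ (m + 1) / ((m + 1)! : ℝ))
        (y ^ m / (m ! : ℝ)) y := by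
      intro y
      have h1 := (hasDerivAt_pow (m + 1) y).div_const ((m + 1)! : ℝ)
      convert! h1 using 1
      rw [Nat.factorial_succ]
      have : (m ! : ℝ) ≠ 0 := by exact_mod_cast m.factorial_ne_zero
      have : ((m : ℝ) + 1) ≠ 0 := by exact_mod_cast m.succ_ne_zero
      push_cast
      field_simp
    have := image_norm_le_of_norm_deriv_right_le_deriv_boundary
      (f := fun y : ℝ => Complex.exp (y * c) -
        ∑ k ∈ Finset.range (m + 1), ((y : ℂ) * c) ^ k / (k ! : ℂ)) (a := 0) (b := x)
      (fun y _ => (hd y).continuousAt.continuousWithinAt) (fun y _ => (hd y).hasDerivWithinAt)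
      (B := fun y => y ^ (m + 1) / ((m + 1)! : ℝ))
      (by simp [Finset.sum_range_succ']) hB (fun y hy => by
        rw [norm_mul, hc, one_mul]
        exact ih hy.1)
    exact this ⟨hx, le_rfl⟩

lemma norm_exp_mul_I_sub_taylor_le (m : ℕ) (x : ℝ) :
    ‖Complex.exp (x * Complex.I) - ∑ k ∈ Finset.range m, ((x : ℂ) * Complex.I) ^ k / (k ! : ℂ)‖ ≤
      |x| ^ m / (m ! : ℝ) := by
  rcases le_total 0 x with h | h
  · rw [abs_of_nonneg h]
    exact norm_exp_sub_taylor_le Complex.I (by simp) (by simp) m h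
  · rw [abs_of_nonpos h]
    have := norm_exp_sub_taylor_le (-Complex.I) (by simp) (by simp) m (neg_nonneg.2 h)
    simpa using this

/-- The Taylor order is even so that `|L|^{2J} = L^{2J}` is an ordinary moment. -/
lemma norm_integral_exp_sub_le {Ω : Type*} [MeasurableSpace Ω] {P : Measure Ω}
    [IsProbabilityMeasure P] {L : Ω → ℝ} (hm : AEMeasurable L P)
    (hL : ∀ k : ℕ, Integrable (fun ω => L ω ^ k) P) (J : ℕ) :
    ‖∫ ω, Complex.exp (L ω * Complex.I) ∂P - ∑ k ∈ Finset.range (2 * J),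
      ((∫ ω, L ω ^ k ∂P : ℝ) : ℂ) * (Complex.I ^ k / (k ! : ℂ))‖ ≤
      (∫ ω, L ω ^ (2 * J) ∂P) / ((2 * J)! : ℝ) := by
  have hexp : Integrable (fun ω => Complex.exp (L ω * Complex.I)) P := by
    refine Integrable.of_bound (C := 1) ?_ (.of_forall fun ω => ?_)
    · exact (Complex.measurable_exp.comp_aemeasurable
        ((Complex.measurable_ofReal.comp_aemeasurable hm).mul_const _)).aestronglyMeasurable
    · rw [Complex.norm_exp_ofReal_mul_I]
  have hk : ∀ k ∈ Finset.range (2 * J),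
      Integrable (fun ω => ((L ω : ℂ) * Complex.I) ^ k / (k ! : ℂ)) P := by
    intro k _
    have := ((hL k).ofReal (𝕜 := ℂ)).mul_const (Complex.I ^ k / (k ! : ℂ))
    refine this.congr (.of_forall fun ω => ?_)
    simp [mul_pow]
    ring
  have hsum : ∑ k ∈ Finset.range (2 * J),
      ((∫ ω, L ω ^ k ∂P : ℝ) : ℂ) * (Complex.I ^ k / (k ! : ℂ)) =
      ∫ ω, ∑ k ∈ Finset.range (2 * J), ((L ω : ℂ) * Complex.I) ^ k / (k ! : ℂ) ∂P := by
    rw [integral_finsetSum _ hk]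
    refine Finset.sum_congr rfl fun k _ => ?_
    rw [← integral_complex_ofReal, ← integral_mul_const]
    refine integral_congr_ae (.of_forall fun ω => ?_)
    simp [mul_pow]
    ring
  rw [hsum, ← integral_sub hexp (integrable_finsetSum _ hk), ← integral_div]
  refine (norm_integral_le_integral_norm _).trans (integral_mono_of_nonneg
    (.of_forall fun ω => norm_nonneg _) ((hL _).div_const _) (.of_forall fun ω => ?_))
  refine (norm_exp_mul_I_sub_taylor_le (2 * J) (L ω)).trans_eq ?_
  simp only [pow_mul, sq_abs]

/-- Convergence of moments implies convergence of characteristic functions, if the limit has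
small moments. -/
lemma tendsto_integral_exp_of_moments {Ω Ω' : Type*} [MeasurableSpace Ω] [MeasurableSpace Ω']
    {P : Measure Ω} {P' : Measure Ω'} [IsProbabilityMeasure P] [IsProbabilityMeasure P']
    {L : ℕ → Ω → ℝ} {L' : Ω' → ℝ} (hm : ∀ n, AEMeasurable (L n) P) (hm' : AEMeasurable L' P')
    (hL : ∀ n (k : ℕ), Integrable (fun ω => L n ω ^ k) P)
    (hL' : ∀ k : ℕ, Integrable (fun ω => L' ω ^ k) P')
    (hmom : ∀ k : ℕ, Tendsto (fun n => ∫ ω, L n ω ^ k ∂P) atTop (𝓝 (∫ ω, L' ω ^ k ∂P')))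
    (hsmall : Tendsto (fun J : ℕ => (∫ ω, L' ω ^ (2 * J) ∂P') / ((2 * J)! : ℝ)) atTop (𝓝 0)) :
    Tendsto (fun n => ∫ ω, Complex.exp (L n ω * Complex.I) ∂P) atTop
      (𝓝 (∫ ω, Complex.exp (L' ω * Complex.I) ∂P')) := by
  rw [Metric.tendsto_nhds]
  intro ε hε
  -- `J` is fixed by the limit alone. For large `n` the remainder of `L n` is small too, since its
  -- moment of order `2J` converges, and the Taylor sums differ by less than `ε / 3`.
  obtain ⟨J, hJ⟩ := (hsmall.eventually (gt_mem_nhds (show (0 : ℝ) < ε / 3 by positivity))).exists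
  have h1 : Tendsto (fun n => (∫ ω, L n ω ^ (2 * J) ∂P) / ((2 * J)! : ℝ)) atTop
      (𝓝 ((∫ ω, L' ω ^ (2 * J) ∂P') / ((2 * J)! : ℝ))) := (hmom _).div_const _
  have h2 : Tendsto (fun n => ∑ k ∈ Finset.range (2 * J),
      ((∫ ω, L n ω ^ k ∂P : ℝ) : ℂ) * (Complex.I ^ k / (k ! : ℂ))) atTop
      (𝓝 (∑ k ∈ Finset.range (2 * J),
        ((∫ ω, L' ω ^ k ∂P' : ℝ) : ℂ) * (Complex.I ^ k / (k ! : ℂ)))) :=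
    tendsto_finsetSum _ fun k _ =>
      ((Complex.continuous_ofReal.tendsto _).comp (hmom k)).mul_const _
  filter_upwards [h1.eventually (gt_mem_nhds hJ), Metric.tendsto_nhds.1 h2 (ε / 3) (by positivity)]
    with n hn1 hn2
  have e1 := norm_integral_exp_sub_le (hm n) (hL n) J
  have e2 := norm_integral_exp_sub_le hm' hL' J
  rw [← dist_eq_norm] at e1 e2
  rw [dist_comm] at e2
  have t1 := dist_triangle4 (∫ ω, Complex.exp (L n ω * Complex.I) ∂P)
    (∑ k ∈ Finset.range (2 * J), ((∫ ω, L n ω ^ k ∂P : ℝ) : ℂ) * (Complex.I ^ k / (k ! : ℂ)))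
    (∑ k ∈ Finset.range (2 * J), ((∫ ω, L' ω ^ k ∂P' : ℝ) : ℂ) * (Complex.I ^ k / (k ! : ℂ)))
    (∫ ω, Complex.exp (L' ω * Complex.I) ∂P')
  linarith

/-- The even moments of a linear form under a Gaussian functional. -/
lemma IsGaussianFunctional.even_moments {σ : Type*} [Fintype σ] {c : σ → σ → ℝ}
    {F : MvPolynomial σ ℝ →ₗ[ℝ] ℝ} (hF : IsGaussianFunctional c F) (u : σ → ℝ) (J : ℕ) :
    F ((∑ a, u a • X a) ^ (2 * J)) / ((2 * J)! : ℝ) =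
      ((∑ a, ∑ b, u a * (u b * c a b)) / 2) ^ J / (J ! : ℝ) := by
  set v := ∑ a, ∑ b, u a * (u b * c a b)
  set L : MvPolynomial σ ℝ := ∑ a, u a • X a with hLdef
  let D : Derivation ℝ (MvPolynomial σ ℝ) (MvPolynomial σ ℝ) := ∑ a, u a • gaussDeriv c a
  have hD : ∀ p, F (L * p) = F (D p) := by
    intro p
    simp only [hLdef, D, Finset.sum_mul, map_sum, derivation_sum_apply, Derivation.smul_apply,
      map_smul, smul_mul_assoc, hF.ibp]
  -- The derivation along `u` sends `L` to its variance `v`, so `F(L^{2J+2}) = (2J+1) v F(L^{2J})`.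
  have hDL : D L = C v := by
    have hX : ∀ a, D (X a) = C (∑ b, u b * c b a) := fun a => by
      simp only [D, derivation_sum_apply, Derivation.smul_apply, gaussDeriv_X, smul_eq_C_mul,
        map_sum, C_mul]
    have hL : D L = ∑ a, u a • C (∑ b, u b * c b a) := by
      rw [hLdef, map_sum]
      exact Finset.sum_congr rfl fun a _ => by rw [D.map_smul, hX]
    simp only [hL, v, smul_eq_C_mul, ← C_mul, ← map_sum, Finset.mul_sum]
    rw [Finset.sum_comm]
    congr 1
    refine Finset.sum_congr rfl fun a _ => Finset.sum_congr rfl fun b _ => ?_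
    ring
  induction J with
  | zero => simp [hF.map_one]
  | succ J ih =>
    have h : F (L ^ (2 * (J + 1))) = (2 * J + 1) * v * F (L ^ (2 * J)) := by
      have h2 : D (L ^ (2 * J + 1)) = ((2 * (J : ℝ) + 1) * v) • L ^ (2 * J) := by
        rw [Derivation.leibniz_pow, hDL, Nat.add_sub_cancel, smul_eq_C_mul, smul_eq_mul,
          nsmul_eq_mul]
        simp only [map_add, map_mul, C_1, map_ofNat, map_natCast]
        push_cast
        ring
      rw [show 2 * (J + 1) = 2 * J + 1 + 1 by ring, pow_succ', hD, h2, map_smul, smul_eq_mul]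
    have hJ : ((2 * J)! : ℝ) ≠ 0 := by exact_mod_cast (2 * J).factorial_ne_zero
    have hJ' : (J ! : ℝ) ≠ 0 := by exact_mod_cast J.factorial_ne_zero
    have h1 : ((J : ℝ) + 1) ≠ 0 := by positivity
    have h2 : (2 * (J : ℝ) + 1) ≠ 0 := by positivity
    rw [div_eq_iff hJ] at ih
    rw [h, ih, show 2 * (J + 1) = 2 * J + 1 + 1 by ring, Nat.factorial_succ, Nat.factorial_succ,
      Nat.factorial_succ]
    push_cast
    field_simp
    ring

lemma charFun_map_toLp {Ω σ : Type*} [MeasurableSpace Ω] [Fintype σ] {P : Measure Ω}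
    {W : σ → Ω → ℝ} (hW : ∀ s, AEMeasurable (W s) P) (u : EuclideanSpace ℝ σ) :
    charFun (P.map fun ω => (WithLp.toLp 2 fun s => W s ω : EuclideanSpace ℝ σ)) u =
      ∫ ω, Complex.exp (((eval (fun s => W s ω) (∑ s, u s • X s) : ℝ) : ℂ) * Complex.I) ∂P := by
  have hm : AEMeasurable (fun ω => (WithLp.toLp 2 fun s => W s ω : EuclideanSpace ℝ σ)) P :=
    (WithLp.measurable_toLp 2 _).comp_aemeasurable (aemeasurable_pi_lambda _ hW)
  rw [charFun_apply, integral_map hm (by fun_prop)]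
  refine integral_congr_ae (.of_forall fun ω => ?_)
  simp [PiLp.inner_apply]

/-- The method of moments for a Gaussian limit. -/
theorem tendstoInDistribution_of_moments {Ω Ω' σ : Type*} [MeasurableSpace Ω]
    [MeasurableSpace Ω'] [Fintype σ] {P : Measure Ω} {P' : Measure Ω'}
    [IsProbabilityMeasure P] [IsProbabilityMeasure P'] {Y : ℕ → σ → Ω → ℝ} {Z : σ → Ω' → ℝ}
    (hm : ∀ n s, AEMeasurable (Y n s) P)
    (hY : ∀ n (p : MvPolynomial σ ℝ), Integrable (fun ω => eval (fun s => Y n s ω) p) P)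
    (hZ : IsGaussianProcess Z P') {c : σ → σ → ℝ} (hF : IsGaussianFunctional c (expect hZ))
    (hmom : ∀ p : MvPolynomial σ ℝ, Tendsto (fun n => ∫ ω, eval (fun s => Y n s ω) p ∂P) atTop
      (𝓝 (expect hZ p))) :
    TendstoInDistribution (fun n ω s => Y n s ω) atTop (fun ω s => Z s ω) (fun _ => P) P' := by
  have hmY : ∀ n, AEMeasurable (fun ω => WithLp.toLp 2 fun s => Y n s ω) P := fun n =>
    (WithLp.measurable_toLp 2 _).comp_aemeasurable (aemeasurable_pi_lambda _ (hm n))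
  have hmZ : AEMeasurable (fun ω => WithLp.toLp 2 fun s => Z s ω) P' :=
    (WithLp.measurable_toLp 2 _).comp_aemeasurable (aemeasurable_pi_lambda _ hZ.aemeasurable)
  have key : TendstoInDistribution
      (fun n ω => (WithLp.toLp 2 fun s => Y n s ω : EuclideanSpace ℝ σ)) atTop
      (fun ω => (WithLp.toLp 2 fun s => Z s ω : EuclideanSpace ℝ σ)) (fun _ => P) P' := by
    refine ⟨hmY, hmZ, ?_⟩
    refine ProbabilityMeasure.tendsto_of_tendsto_charFun fun u => ?_
    change Tendsto (fun n => charFun (P.map fun ω =>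
      (WithLp.toLp 2 fun s => Y n s ω : EuclideanSpace ℝ σ)) u) atTop (𝓝 (charFun (P'.map fun ω =>
      (WithLp.toLp 2 fun s => Z s ω : EuclideanSpace ℝ σ)) u))
    rw [charFun_map_toLp hZ.aemeasurable]
    simp only [charFun_map_toLp (hm _)]
    have hsmall : Tendsto (fun J : ℕ => expect hZ ((∑ s, u s • X s) ^ (2 * J)) / ((2 * J)! : ℝ))
        atTop (𝓝 0) := by
      simp only [hF.even_moments]
      -- The normalized even moments are `(v/2)^J / J!`, which tends to zero.
      exact FloorSemiring.tendsto_pow_div_factorial_atTop _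
    generalize (∑ s, u s • X s : MvPolynomial σ ℝ) = p at hsmall ⊢
    refine tendsto_integral_exp_of_moments (fun n => ?_) ?_ (fun n k => ?_) (fun k => ?_)
      (fun k => ?_) ?_
    · exact (hY n p).aestronglyMeasurable.aemeasurable
    · exact (integrable_eval hZ p).aestronglyMeasurable.aemeasurable
    · simpa only [map_pow] using hY n (p ^ k)
    · simpa only [map_pow] using integrable_eval hZ (p ^ k)
    · simpa only [map_pow, expect, LinearMap.coe_mk, AddHom.coe_mk] using hmom (p ^ k)
    · simpa only [map_pow, expect, LinearMap.coe_mk, AddHom.coe_mk] using hsmall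
  exact key.continuous_comp (g := WithLp.ofLp) (by fun_prop)

end Convergence

/-! ### Finite-dimensional distributions -/

section FiniteDimensional

open MvPolynomial
open scoped Topology

variable {Ω : Type*} [MeasurableSpace Ω] {P : Measure Ω}

lemma eTilde_eq_levelEntry {n K : ℕ} (A : Matrix (Fin (n + 1)) (Fin (n + 1)) ℝ)
    (c : Fin K ⊕ Fin K) : eTilde K A c = levelEntry (entryLevel c) A := by
  rcases c with k | k
  · exact aTilde_eq_levelEntry _ A
  · exact bScaled_eq_levelEntry _ A

/-- The rewriting as a polynomial in the entries holds for `n = 0` too, so integrability is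
available along the whole sequence. -/
lemma integrable_eval_levelEntry {σ : Type*} {n : ℕ}
    {M : ℝ≥0 → Ω → Matrix (Fin (n + 1)) (Fin (n + 1)) ℝ} (hM : IsGOEProcess M P) (κ : σ → ℕ)
    (t : σ → ℝ≥0) (p : MvPolynomial σ ℝ) :
    Integrable (fun ω => eval (fun s => levelEntry (κ s) (M (t s) ω)) p) P := by
  have h : ∀ ω, eval (fun s => levelEntry (κ s) (M (t s) ω)) p =
      eval (entryAssign fun i => M (t i) ω)
        (aeval (atomVal (ouCorr t)) (aeval (slotPoly κ) p)) := by
    intro ω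
    induction p using MvPolynomial.induction_on with
    | C r => simp
    | add p q hp hq => simp only [map_add, hp, hq]
    | mul_X p s hp =>
      rw [map_mul, hp, eval_X, map_mul, map_mul, map_mul, aeval_X,
        eval_slotPoly (ouCorr t) (ouCorr_self t) (fun i => M (t i) ω) fun i => hM.isSymm (t i) ω]
  simp only [h]
  exact integrable_eval (isGaussianProcess_entryAssign hM t) _

/-- All mixed moments of the levels converge to those of a Gaussian functional. -/
lemma tendsto_integral_eval_levelEntry {σ : Type*} [Countable σ]
    {M : (n : ℕ) → ℝ≥0 → Ω → Matrix (Fin (n + 1)) (Fin (n + 1)) ℝ}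
    (hM : ∀ n, IsGOEProcess (M n) P) (κ : σ → ℕ) (t : σ → ℝ≥0) {F : MvPolynomial σ ℝ →ₗ[ℝ] ℝ}
    (hF : IsGaussianFunctional (slotCov (ouCorr t) κ) F) (p : MvPolynomial σ ℝ) :
    Tendsto (fun n => ∫ ω, eval (fun s => levelEntry (κ s) (M n (t s) ω)) p ∂P) atTop
      (𝓝 (F p)) := by
  induction p using lprod_induction with
  | hl l =>
    -- A monomial is a first block of variables with an empty second block; no separation of levels
    -- is then required.
    have hl : lprod l = (∏ i, X (l.get i)) * ∏ i : Fin 0, X (Fin.elim0 i : σ) := by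
      rw [Fin.prod_univ_zero, mul_one, lprod, ← List.prod_ofFn]
      simp
    obtain ⟨C, hC⟩ := moments_levelEntry hM κ l.get (fun i : Fin 0 => (Fin.elim0 i : σ))
      fun _ b => b.elim0
    have hlim : Tendsto (fun n : ℕ => C / √(n : ℝ)) atTop (𝓝 0) :=
      tendsto_const_nhds.div_atTop (Real.tendsto_sqrt_atTop.comp tendsto_natCast_atTop_atTop)
    rw [tendsto_iff_dist_tendsto_zero]
    refine squeeze_zero' (.of_forall fun n => dist_nonneg) ?_ hlim
    filter_upwards [eventually_ge_atTop 1] with n hn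
    rw [Real.dist_eq, hl, hF.wick l.get _ fun _ b => b.elim0]
    simpa only [map_mul, map_prod, eval_X] using (hC n hn t).2
  | hadd p q hp hq =>
    simp only [map_add]
    refine (hp.add hq).congr fun n => ?_
    exact (integral_add (integrable_eval_levelEntry (hM n) κ t p)
      (integrable_eval_levelEntry (hM n) κ t q)).symm
  | hsmul r p hp =>
    simp only [map_smul, smul_eval, smul_eq_mul]
    refine (hp.const_mul r).congr fun n => ?_
    exact (integral_const_mul r _).symm

/-- Convergence of the finite-dimensional distributions. -/
theorem tendstoInDistribution_eTilde {Ω' : Type*} [MeasurableSpace Ω'] {P' : Measure Ω'}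
    [IsProbabilityMeasure P] [IsProbabilityMeasure P']
    {M : (n : ℕ) → ℝ≥0 → Ω → Matrix (Fin (n + 1)) (Fin (n + 1)) ℝ}
    (hM : ∀ n, IsGOEProcess (M n) P) {K : ℕ} {E : Fin K ⊕ Fin K → ℝ≥0 → Ω' → ℝ}
    (hE : IsVectorOU (Sum.elim (fun k : Fin K => rateA k) (fun k : Fin K => rateB k))
      (fun c t ω => (1 / √2) * E c t ω) P') (j : ℕ) (t : Fin j → ℝ≥0) :
    TendstoInDistribution (fun (n : ℕ) (ω : Ω) (i : Fin j) => eTilde K (M n (t i) ω)) atTop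
      (fun (ω : Ω') (i : Fin j) (c : Fin K ⊕ Fin K) => E c (t i) ω) (fun _ => P) P' := by
  let κ : Fin j × (Fin K ⊕ Fin K) → ℕ := fun s => entryLevel s.2
  have hF := isGaussianFunctional_limit hE (fun s : Fin j × (Fin K ⊕ Fin K) => s.2)
    fun s => t s.1
  have hint : ∀ n p, Integrable
      (fun ω => eval (fun s => levelEntry (κ s) (M n (t s.1) ω)) p) P := fun n p =>
    integrable_eval_levelEntry (hM n) κ (fun s => t s.1) p
  have key := tendstoInDistribution_of_moments
    (Y := fun n (s : Fin j × (Fin K ⊕ Fin K)) ω => levelEntry (κ s) (M n (t s.1) ω))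
    (fun n s => by simpa using (hint n (X s)).aestronglyMeasurable.aemeasurable) hint
    (isGaussianProcess_limit hE (fun s : Fin j × (Fin K ⊕ Fin K) => s.2) fun s => t s.1) hF
    (tendsto_integral_eval_levelEntry hM κ (fun s => t s.1) hF)
  have hg : Continuous fun (x : Fin j × (Fin K ⊕ Fin K) → ℝ) (i : Fin j) (c : Fin K ⊕ Fin K) =>
      x (i, c) := by fun_prop
  convert! key.continuous_comp hg using 1
  ext n ω i c
  exact eTilde_eq_levelEntry _ c

end FiniteDimensional

end TridiagGOE

theorem proposition6p2 {Ω : Type*} [MeasurableSpace Ω] (P : Measure Ω) [IsProbabilityMeasure P]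
    (M : (n : ℕ) → ℝ≥0 → Ω → Matrix (Fin (n + 1)) (Fin (n + 1)) ℝ)
    (hM : ∀ n, TridiagGOE.IsGOEProcess (M n) P) :
    -- mixed moments of the approximate entries
    (∀ (j₁ j₂ : ℕ) (k : Fin j₁ → ℕ) (k' : Fin j₂ → ℕ), ∃ C : ℝ,
      ∀ (n : ℕ), 1 ≤ n → ∀ (t : Fin j₁ → ℝ≥0) (t' : Fin j₂ → ℝ≥0),
        Integrable (fun ω => (∏ i, TridiagGOE.aTilde (k i) (M n (t i) ω)) *
          ∏ i, TridiagGOE.bScaled (k' i) (M n (t' i) ω)) P ∧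
        |(∫ ω, (∏ i, TridiagGOE.aTilde (k i) (M n (t i) ω)) *
            ∏ i, TridiagGOE.bScaled (k' i) (M n (t' i) ω) ∂P) -
          TridiagGOE.wickSum TridiagGOE.rateA k t * TridiagGOE.wickSum TridiagGOE.rateB k' t'|
            ≤ C / √(n : ℝ)) ∧
    -- the limit process `E = (A₁, …, A_K, B₁, …, B_K)`
    (∀ {Ω' : Type*} [MeasurableSpace Ω'] (P' : Measure Ω') [IsProbabilityMeasure P'] (K : ℕ)
      (E : Fin K ⊕ Fin K → ℝ≥0 → Ω' → ℝ),
      TridiagGOE.IsVectorOU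
        (Sum.elim (fun k : Fin K => TridiagGOE.rateA k) (fun k : Fin K => TridiagGOE.rateB k))
        (fun c t ω => (1 / √2) * E c t ω) P' →
      -- its mixed moments are the Wick sums
      (∀ (j₁ j₂ : ℕ) (k : Fin j₁ → Fin K) (k' : Fin j₂ → Fin K)
        (t : Fin j₁ → ℝ≥0) (t' : Fin j₂ → ℝ≥0),
        Integrable (fun ω => (∏ i, E (Sum.inl (k i)) (t i) ω) *
          ∏ i, E (Sum.inr (k' i)) (t' i) ω) P' ∧
        ∫ ω, (∏ i, E (Sum.inl (k i)) (t i) ω) * ∏ i, E (Sum.inr (k' i)) (t' i) ω ∂P' =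
          TridiagGOE.wickSum TridiagGOE.rateA (fun i => (k i : ℕ)) t *
            TridiagGOE.wickSum TridiagGOE.rateB (fun i => (k' i : ℕ)) t') ∧
      -- convergence of the finite dimensional distributions
      (∀ (j : ℕ) (t : Fin j → ℝ≥0),
        TendstoInDistribution
          (fun (n : ℕ) (ω : Ω) (i : Fin j) => TridiagGOE.eTilde K (M n (t i) ω))
          atTop (fun (ω : Ω') (i : Fin j) (c : Fin K ⊕ Fin K) => E c (t i) ω)
          (fun _ => P) P')) := by
  exact ⟨TridiagGOE.moments_approx hM, fun P' _ K E hE =>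
    ⟨TridiagGOE.moments_limit hE, TridiagGOE.tendstoInDistribution_eTilde hM hE⟩⟩
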